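/- Let $G$ be a locally compact (Hausdorff) abelian group, written additively, with a fixed Haar measure $ds$. Let $(\Phi,\Psi)$ be a complementary pair of continuous, strictly increasing Young functions $[0,\infty)\to[0,\infty)$; that is, $\Phi$ and $\Psi$ are convex, vanish at $0$, tend to $\infty$ at $\infty$, and $\Psi(y)=\sup\{xy-\Phi(x):x\ge 0\}$ for $y\ge 0$. Let $L^\Phi(G)$ be the Orlicz space of (classes of) measurable $f:G\to\mathbb C$ with $\int_G\Phi(\alpha|f(s)|)\,ds<\infty$ for some $\alpha>0$, with the norm $\|f\|_\Phi=\sup\{\int_G|fv|\,ds:\int_G\Psi(|v|)\,ds\le 1\}$, and let $\mathcal S^\Phi(G)$ be the closure in $L^\Phi(G)$ of the step functions belonging to $L^\Phi(G)$. Let $\omega:G\to(0,\infty)$ be a weight: a measurable, locally integrable function with $\omega(0)=1$, $1/\omega\in L^\infty(G)$ and, for some $C>0$, $\omega(s+t)\le C\,\omega(s)\omega(t)$ for all $s,t\in G$. Put $$L^\Phi_\omega(G)=\{f: f\omega\in L^\Phi(G)\},\qquad \mathcal S^\Phi_\omega(G)=\{f: f\omega\in \mathcal S^\Phi(G)\},\qquad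 \|f\|_{\Phi,\omega}=\|f\omega\|_\Phi .$$ Suppose that $L^\Phi_\omega(G)$ is a Banach algebra under convolution, in the sense of bounded (not necessarily contractive) multiplication: for $f,g\in L^\Phi_\omega(G)$ the integral $(f*g)(x)=\int_G f(s)g(x-s)\,ds$ converges absolutely for almost every $x$, and $(f,g)\mapsto f*g$ is a bounded associative bilinear multiplication on $L^\Phi_\omega(G)$. Suppose further that there is no nonzero continuous group homomorphism $\xi:G\to(\mathbb C,+)$ such that the function $$\tilde\xi(s)=\frac{\xi(s)}{\omega(s)\,\omega(-s)}\qquad(s\in G)$$ belongs to $L^\infty(G)$. Then $A=\mathcal S^\Phi_\omega(G)$ is an algebra under convolution, with bounded multiplication, and it is weakly amenable: every bounded derivation $D:A\to A^*$, i.e. every bounded linear map with $D(ab)=a\cdot D(b)+D(a)\cdot b$, where $(a\cdot\varphi)(c)=\varphi(ca)$ and $(\varphi\cdot a)(c)=\varphi(ac)$, is inner, i.e. there is $\varphi\in A^*$ with $D(a)=a\cdot\varphi-\varphi\cdot a$ for all $a\in A$. -/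

import Mathlib

open MeasureTheory Filter Topology
open scoped NNReal ENNReal Convolution

noncomputable section

namespace WeightedOrlicz

/-! ### Young functions -/

/-- A continuous, strictly increasing Young function `[0, ∞) → [0, ∞)`. A strictly increasing
function cannot take the value `∞`, so the codomain is `ℝ≥0`. -/
structure IsYoungFunction (Φ : ℝ≥0 → ℝ≥0) : Prop where
  convex : ConvexOn ℝ≥0 Set.univ Φ
  map_zero : Φ 0 = 0
  tendsto_atTop : Tendsto Φ atTop atTop
  continuous : Continuous Φ
  strictMono : StrictMono Φ

/-- A complementary pair `(Φ, Ψ)` of continuous, strictly increasing Young functions: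
`Ψ y = sup {x y - Φ x : x ≥ 0}`. -/
structure YoungPair where
  Φ : ℝ≥0 → ℝ≥0
  Ψ : ℝ≥0 → ℝ≥0
  young_left : IsYoungFunction Φ
  young_right : IsYoungFunction Ψ
  isLUB : ∀ y : ℝ≥0, IsLUB (Set.range fun x : ℝ≥0 => (x : ℝ) * y - Φ x) (Ψ y)

theorem YoungPair.young_ineq (Y : YoungPair) (x y : ℝ≥0) : x * y ≤ Y.Φ x + Y.Ψ y := by
  have h := (Y.isLUB y).1 ⟨x, rfl⟩
  have h' : (x : ℝ) * y ≤ Y.Φ x + Y.Ψ y := by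
    simp only at h
    linarith
  exact_mod_cast h'

theorem IsYoungFunction.le_half {Φ : ℝ≥0 → ℝ≥0} (h : IsYoungFunction Φ) (x y : ℝ≥0) :
    Φ (2⁻¹ * x + 2⁻¹ * y) ≤ Φ x + Φ y := by
  have h1 := h.convex.2 (Set.mem_univ x) (Set.mem_univ y) (zero_le (a := (2⁻¹ : ℝ≥0)))
    (zero_le (a := (2⁻¹ : ℝ≥0))) (by rw [← two_mul]; exact mul_inv_cancel₀ two_ne_zero)
  simp only [smul_eq_mul] at h1
  have h2 : (2⁻¹ : ℝ≥0) ≤ 1 := by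
    rw [inv_le_one₀ (by norm_num)]; norm_num
  calc _ ≤ _ := h1
    _ ≤ 1 * Φ x + 1 * Φ y := by gcongr
    _ = _ := by rw [one_mul, one_mul]

/-! ### Orlicz spaces -/

section Orlicz

variable {X : Type*} [MeasurableSpace X]

/-- The modular `∫ Φ(|f|) dμ`. -/
def modular (Φ : ℝ≥0 → ℝ≥0) (μ : Measure X) (f : X → ℂ) : ℝ≥0∞ :=
  ∫⁻ s, (Φ ‖f s‖₊ : ℝ≥0∞) ∂μ

/-- The Orlicz space `L^Φ(μ)`: classes of measurable functions `f` such that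
`∫ Φ(α |f|) dμ < ∞` for some `α > 0`. -/
def orlicz (Y : YoungPair) (μ : Measure X) : Submodule ℂ (X →ₘ[μ] ℂ) where
  carrier := {f | ∃ α : ℝ≥0, 0 < α ∧ modular Y.Φ μ (fun s => (α : ℂ) * f s) < ∞}
  zero_mem' := by
    refine ⟨1, one_pos, ?_⟩
    have : modular Y.Φ μ (fun s => ((1 : ℝ≥0) : ℂ) * (0 : X →ₘ[μ] ℂ) s) = 0 := by
      unfold modular
      rw [lintegral_congr_ae (g := fun _ => 0), lintegral_zero]
      filter_upwards [AEEqFun.coeFn_zero (α := X) (β := ℂ) (μ := μ)] with s hs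
      simp [hs, Y.young_left.map_zero]
    rw [this]
    exact ENNReal.zero_lt_top
  add_mem' := by
    rintro f g ⟨α, hα, hf⟩ ⟨β, hβ, hg⟩
    refine ⟨2⁻¹ * min α β, by positivity, ?_⟩
    refine lt_of_le_of_lt ?_ (ENNReal.add_lt_top.2 ⟨hf, hg⟩)
    have hmeas : AEMeasurable (fun s => (Y.Φ ‖(α : ℂ) * f s‖₊ : ℝ≥0∞)) μ := by
      have h1 : Measurable fun s => (α : ℂ) * f s := f.measurable.const_mul _
      exact (Y.young_left.continuous.measurable.comp h1.nnnorm).coe_nnreal_ennreal.aemeasurable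
    unfold modular
    rw [← lintegral_add_left' hmeas]
    refine lintegral_mono_ae ?_
    filter_upwards [AEEqFun.coeFn_add f g] with s hs
    rw [hs]
    norm_cast
    refine le_trans (Y.young_left.strictMono.monotone ?_) (Y.young_left.le_half _ _)
    simp only [Pi.add_apply, nnnorm_mul]
    have e : ∀ r : ℝ≥0, ‖(r : ℂ)‖₊ = r := fun r => by
      ext; simp
    rw [e, e, e, mul_assoc, ← mul_add]
    gcongr
    calc min α β * ‖f s + g s‖₊ ≤ min α β * (‖f s‖₊ + ‖g s‖₊) := by
          gcongr; exact nnnorm_add_le _ _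
      _ = min α β * ‖f s‖₊ + min α β * ‖g s‖₊ := mul_add _ _ _
      _ ≤ _ := by gcongr <;> simp
  smul_mem' := by
    rintro c f ⟨α, hα, hf⟩
    refine ⟨α / (‖c‖₊ + 1), by positivity, lt_of_le_of_lt ?_ hf⟩
    refine lintegral_mono_ae ?_
    filter_upwards [AEEqFun.coeFn_smul c f] with s hs
    rw [hs]
    norm_cast
    refine Y.young_left.strictMono.monotone ?_
    have e : ∀ r : ℝ≥0, ‖(r : ℂ)‖₊ = r := fun r => by
      ext; simp
    simp only [Pi.smul_apply, smul_eq_mul, nnnorm_mul]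
    rw [e, e, ← mul_assoc]
    gcongr
    rw [div_mul_eq_mul_div, div_le_iff₀ (by positivity)]
    gcongr
    simp

/-- The Orlicz norm `sup {∫ |f v| dμ : ∫ Ψ(|v|) dμ ≤ 1}`, as an extended real number. -/
def orliczENorm (Y : YoungPair) {μ : Measure X} (f : X →ₘ[μ] ℂ) : ℝ≥0∞ :=
  ⨆ (v : X →ₘ[μ] ℂ) (_ : modular Y.Ψ μ v ≤ 1), ∫⁻ s, ‖f s * v s‖ₑ ∂μ

variable {Y : YoungPair} {μ : Measure X}

theorem orliczENorm_lt_top {f : X →ₘ[μ] ℂ} (hf : f ∈ orlicz Y μ) : orliczENorm Y f < ∞ := by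
  obtain ⟨α, hα, hf⟩ := hf
  have hα' : (α : ℝ≥0∞) ≠ 0 := by simpa using hα.ne'
  suffices h : orliczENorm Y f ≤ (modular Y.Φ μ (fun s => (α : ℂ) * f s) + 1) / α from
    lt_of_le_of_lt h (ENNReal.div_lt_top (by simp [hf.ne]) hα')
  refine iSup₂_le fun v hv => ?_
  rw [ENNReal.le_div_iff_mul_le (Or.inl hα') (Or.inl ENNReal.coe_ne_top), mul_comm]
  rw [← lintegral_const_mul' _ _ ENNReal.coe_ne_top]
  have hmeas : Measurable (fun s => (Y.Φ ‖(α : ℂ) * f s‖₊ : ℝ≥0∞)) :=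
    (Y.young_left.continuous.measurable.comp
      (f.measurable.const_mul (α : ℂ)).nnnorm).coe_nnreal_ennreal
  calc ∫⁻ s, (α : ℝ≥0∞) * ‖f s * v s‖ₑ ∂μ
      ≤ ∫⁻ s, ((Y.Φ ‖(α : ℂ) * f s‖₊ : ℝ≥0∞) + (Y.Ψ ‖v s‖₊ : ℝ≥0∞)) ∂μ := by
        refine lintegral_mono fun s => ?_
        have h := Y.young_ineq ‖(α : ℂ) * f s‖₊ ‖v s‖₊
        have e : ‖(α : ℂ)‖₊ = α := by ext; simp
        rw [nnnorm_mul, e] at h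
        simp only [enorm_eq_nnnorm, nnnorm_mul, e]
        rw [mul_assoc] at h
        exact_mod_cast h
    _ = modular Y.Φ μ (fun s => (α : ℂ) * f s) + modular Y.Ψ μ v := lintegral_add_left hmeas _
    _ ≤ _ := by gcongr

theorem orliczENorm_zero : orliczENorm Y (0 : X →ₘ[μ] ℂ) = 0 := by
  refine le_antisymm (iSup₂_le fun v _ => ?_) zero_le
  rw [lintegral_congr_ae (g := fun _ => 0), lintegral_zero]
  filter_upwards [AEEqFun.coeFn_zero (α := X) (β := ℂ) (μ := μ)] with s hs
  simp [hs]

theorem orliczENorm_add_le (f g : X →ₘ[μ] ℂ) :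
    orliczENorm Y (f + g) ≤ orliczENorm Y f + orliczENorm Y g := by
  refine iSup₂_le fun v hv => ?_
  calc ∫⁻ s, ‖(f + g : X →ₘ[μ] ℂ) s * v s‖ₑ ∂μ
      ≤ ∫⁻ s, (‖f s * v s‖ₑ + ‖g s * v s‖ₑ) ∂μ := by
        refine lintegral_mono_ae ?_
        filter_upwards [AEEqFun.coeFn_add f g] with s hs
        rw [hs, Pi.add_apply, add_mul]
        exact enorm_add_le _ _
    _ = ∫⁻ s, ‖f s * v s‖ₑ ∂μ + ∫⁻ s, ‖g s * v s‖ₑ ∂μ :=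
        lintegral_add_left (f.measurable.mul v.measurable).enorm _
    _ ≤ _ := add_le_add
        (le_iSup₂ (f := fun (v : X →ₘ[μ] ℂ) (_ : modular Y.Ψ μ v ≤ 1) =>
          ∫⁻ s, ‖f s * v s‖ₑ ∂μ) v hv)
        (le_iSup₂ (f := fun (v : X →ₘ[μ] ℂ) (_ : modular Y.Ψ μ v ≤ 1) =>
          ∫⁻ s, ‖g s * v s‖ₑ ∂μ) v hv)

theorem orliczENorm_smul (c : ℂ) (f : X →ₘ[μ] ℂ) :
    orliczENorm Y (c • f) = ‖c‖ₑ * orliczENorm Y f := by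
  unfold orliczENorm
  simp only [ENNReal.mul_iSup]
  refine iSup_congr fun v => iSup_congr fun _ => ?_
  rw [← lintegral_const_mul' _ _ enorm_ne_top]
  refine lintegral_congr_ae ?_
  filter_upwards [AEEqFun.coeFn_smul c f] with s hs
  rw [hs, Pi.smul_apply, smul_eq_mul, mul_assoc, enorm_mul]

theorem eq_zero_of_orliczENorm_eq_zero {f : X →ₘ[μ] ℂ} (hf : f ∈ orlicz Y μ)
    (h : orliczENorm Y f = 0) : f = 0 := by
  obtain ⟨α, hα, hf⟩ := hf
  have hsmall : ∀ n : ℕ, μ {s | 1 / ((n : ℝ≥0) + 1) ≤ ‖f s‖₊} = 0 := by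
    intro n
    set ε : ℝ≥0 := 1 / ((n : ℝ≥0) + 1) with hε
    have hεpos : 0 < ε := by positivity
    set A : Set X := {s | ε ≤ ‖f s‖₊} with hA
    have hAm : MeasurableSet A := measurableSet_le measurable_const f.measurable.nnnorm
    have hΦpos : 0 < Y.Φ (α * ε) := by
      rw [← Y.young_left.map_zero]
      exact Y.young_left.strictMono (by positivity)
    have hAfin : μ A ≠ ∞ := by
      intro htop
      have h1 : (Y.Φ (α * ε) : ℝ≥0∞) * μ A ≤ modular Y.Φ μ (fun s => (α : ℂ) * f s) := by
        rw [← setLIntegral_const]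
        refine le_trans (setLIntegral_mono' hAm fun s hs => ?_) (setLIntegral_le_lintegral A _)
        norm_cast
        refine Y.young_left.strictMono.monotone ?_
        have e : ‖(α : ℂ)‖₊ = α := by ext; simp
        rw [nnnorm_mul, e]
        gcongr
        exact hs
      rw [htop, ENNReal.mul_top (by exact_mod_cast hΦpos.ne')] at h1
      exact absurd hf (not_lt.2 h1)
    obtain ⟨c, hc, hcA⟩ : ∃ c : ℝ≥0, 0 < c ∧ (Y.Ψ c : ℝ≥0∞) * μ A ≤ 1 := by
      have hpos : 0 < ((μ A).toNNReal + 1)⁻¹ := by positivity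
      have hcont : ∀ᶠ c in 𝓝 (0 : ℝ≥0), Y.Ψ c < ((μ A).toNNReal + 1)⁻¹ := by
        have := Y.young_right.continuous.tendsto 0
        rw [Y.young_right.map_zero] at this
        exact this.eventually (gt_mem_nhds hpos)
      obtain ⟨c, hc, hlt⟩ := ((hcont.filter_mono nhdsWithin_le_nhds).and
        (self_mem_nhdsWithin (s := Set.Ioi (0 : ℝ≥0)))).exists
      refine ⟨c, hlt, ?_⟩
      rw [← ENNReal.coe_toNNReal hAfin]
      norm_cast
      calc Y.Ψ c * (μ A).toNNReal ≤ ((μ A).toNNReal + 1)⁻¹ * ((μ A).toNNReal + 1) := by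
            gcongr
            simp
        _ = 1 := inv_mul_cancel₀ (by positivity)
    have hec : ‖(c : ℂ)‖₊ = c := by ext; simp
    set v : X →ₘ[μ] ℂ := AEEqFun.mk (A.indicator fun _ => (c : ℂ))
      (stronglyMeasurable_const.indicator hAm).aestronglyMeasurable with hv
    have hvae : v =ᵐ[μ] A.indicator fun _ => (c : ℂ) := AEEqFun.coeFn_mk _ _
    have hvmod : modular Y.Ψ μ v ≤ 1 := by
      refine le_trans (le_of_eq ?_) hcA
      unfold modular
      rw [← setLIntegral_const, ← lintegral_indicator hAm]
      refine lintegral_congr_ae ?_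
      filter_upwards [hvae] with s hs
      rw [hs]
      by_cases hsA : s ∈ A
      · simp [hsA, hec]
      · simp [hsA, Y.young_right.map_zero]
    have hint : ∫⁻ s, ‖f s * v s‖ₑ ∂μ = 0 := by
      refine le_antisymm ?_ zero_le
      rw [← h]
      exact le_iSup₂ (f := fun (v : X →ₘ[μ] ℂ) (_ : modular Y.Ψ μ v ≤ 1) =>
        ∫⁻ s, ‖f s * v s‖ₑ ∂μ) v hvmod
    have hlow : ((ε * c : ℝ≥0) : ℝ≥0∞) * μ A ≤ 0 := by
      rw [← hint, ← setLIntegral_const, ← lintegral_indicator hAm]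
      refine lintegral_mono_ae ?_
      filter_upwards [hvae] with s hs
      rw [hs]
      by_cases hsA : s ∈ A
      · simp only [Set.indicator_of_mem hsA, enorm_eq_nnnorm, nnnorm_mul, hec]
        have : ε ≤ ‖f s‖₊ := hsA
        norm_cast
        gcongr
      · simp [hsA]
    have h0 := le_antisymm hlow zero_le
    rcases mul_eq_zero.1 h0 with h1 | h1
    · exact absurd (by exact_mod_cast h1) (mul_pos hεpos hc).ne'
    · exact h1
  refine AEEqFun.ext ?_
  have hall : ∀ᵐ s ∂μ, ∀ n : ℕ, ¬ (1 / ((n : ℝ≥0) + 1) ≤ ‖f s‖₊) :=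
    ae_all_iff.2 fun n => by
      rw [ae_iff]
      simpa using hsmall n
  filter_upwards [hall, AEEqFun.coeFn_zero (α := X) (β := ℂ) (μ := μ)] with s hs hz
  rw [hz]
  by_contra hne
  have hpos : 0 < ‖f s‖₊ := nnnorm_pos.2 (by simpa using hne)
  obtain ⟨n, hn⟩ := exists_nat_one_div_lt (K := ℝ) (ε := ‖f s‖) (by exact_mod_cast hpos)
  exact hs n (by
    rw [← NNReal.coe_le_coe]
    push_cast
    exact hn.le)

/-- `L^Φ(μ)` with the Orlicz norm. -/
instance instNormedAddCommGroupOrlicz : NormedAddCommGroup (orlicz Y μ) :=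
  AddGroupNorm.toNormedAddCommGroup
    { toFun := fun f => (orliczENorm Y (f : X →ₘ[μ] ℂ)).toReal
      map_zero' := by simp [orliczENorm_zero]
      add_le' := fun f g => by
        rw [← ENNReal.toReal_add (orliczENorm_lt_top f.2).ne (orliczENorm_lt_top g.2).ne]
        refine ENNReal.toReal_mono ?_ (orliczENorm_add_le _ _)
        exact ENNReal.add_ne_top.2 ⟨(orliczENorm_lt_top f.2).ne, (orliczENorm_lt_top g.2).ne⟩
      neg' := fun f => by
        have h := orliczENorm_smul (Y := Y) (-1) (f : X →ₘ[μ] ℂ)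
        have h' : (-1 : ℂ) • (f : X →ₘ[μ] ℂ) = -f := neg_one_smul ℂ (f : X →ₘ[μ] ℂ)
        rw [h'] at h
        rw [Submodule.coe_neg, h]
        simp
      eq_zero_of_map_eq_zero' := fun f hf => by
        refine Subtype.ext (eq_zero_of_orliczENorm_eq_zero f.2 ?_)
        rcases (ENNReal.toReal_eq_zero_iff _).1 hf with h | h
        · exact h
        · exact absurd h (orliczENorm_lt_top f.2).ne }

theorem norm_orlicz_def (f : orlicz Y μ) :
    ‖f‖ = (orliczENorm Y (f : X →ₘ[μ] ℂ)).toReal := rfl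

instance instNormedSpaceOrlicz : NormedSpace ℂ (orlicz Y μ) where
  norm_smul_le c f := by
    rw [norm_orlicz_def, norm_orlicz_def, Submodule.coe_smul, orliczENorm_smul,
      ENNReal.toReal_mul, toReal_enorm]

variable (Y μ)

/-- The step functions (measurable functions with finitely many values) in `L^Φ(μ)`. -/
def stepFunctions : Submodule ℂ (orlicz Y μ) where
  carrier := {f | ∃ g : SimpleFunc X ℂ, (f : X →ₘ[μ] ℂ) =ᵐ[μ] g}
  zero_mem' := ⟨0, by
    filter_upwards [AEEqFun.coeFn_zero (α := X) (β := ℂ) (μ := μ)] with s hs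
    simpa using hs⟩
  add_mem' := by
    rintro f f' ⟨g, hg⟩ ⟨g', hg'⟩
    refine ⟨g + g', ?_⟩
    filter_upwards [AEEqFun.coeFn_add (f : X →ₘ[μ] ℂ) f', hg, hg'] with s h1 h2 h3
    simp [h1, h2, h3]
  smul_mem' := by
    rintro c f ⟨g, hg⟩
    refine ⟨c • g, ?_⟩
    filter_upwards [AEEqFun.coeFn_smul c (f : X →ₘ[μ] ℂ), hg] with s h1 h2
    simp [h1, h2]

/-- `S^Φ(μ)`: the closure of the step functions in `L^Φ(μ)`. -/
def orliczS : Submodule ℂ (orlicz Y μ) := (stepFunctions Y μ).topologicalClosure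

end Orlicz

/-! ### Weights and weighted Orlicz spaces -/

section Weighted

variable {G : Type*} [AddCommGroup G] [TopologicalSpace G] [MeasurableSpace G]

/-- A weight on the (additively written) group `G` with Haar measure `μ`. -/
structure Weight (μ : Measure G) where
  toFun : G → ℝ
  pos : ∀ s, 0 < toFun s
  map_zero : toFun 0 = 1
  aemeasurable : AEMeasurable toFun μ
  locallyIntegrable : LocallyIntegrable toFun μ
  inv_memLp_top : MemLp (fun s => (toFun s)⁻¹) ∞ μ
  weakly_submultiplicative :
    ∃ C : ℝ, 0 < C ∧ ∀ s t, toFun (s + t) ≤ C * (toFun s * toFun t)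

instance {μ : Measure G} : CoeFun (Weight μ) fun _ => G → ℝ := ⟨Weight.toFun⟩

variable {μ : Measure G}

theorem Weight.aestronglyMeasurable (ω : Weight μ) :
    AEStronglyMeasurable (fun s => (ω s : ℂ)) μ :=
  (Complex.measurable_ofReal.comp_aemeasurable ω.aemeasurable).aestronglyMeasurable

/-- The linear map `f ↦ f ω` on classes of measurable functions. -/
def mulWeight (ω : Weight μ) : (G →ₘ[μ] ℂ) →ₗ[ℂ] (G →ₘ[μ] ℂ) where
  toFun f := f * AEEqFun.mk (fun s => (ω s : ℂ)) ω.aestronglyMeasurable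
  map_add' f g := by
    refine AEEqFun.ext ?_
    set w : G →ₘ[μ] ℂ := AEEqFun.mk (fun s => (ω s : ℂ)) ω.aestronglyMeasurable
    filter_upwards [AEEqFun.coeFn_mul (f + g) w, AEEqFun.coeFn_add f g,
      AEEqFun.coeFn_add (f * w) (g * w), AEEqFun.coeFn_mul f w, AEEqFun.coeFn_mul g w]
      with s h1 h2 h3 h4 h5
    simp [h1, h2, h3, h4, h5, add_mul]
  map_smul' c f := by
    refine AEEqFun.ext ?_
    set w : G →ₘ[μ] ℂ := AEEqFun.mk (fun s => (ω s : ℂ)) ω.aestronglyMeasurable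
    filter_upwards [AEEqFun.coeFn_mul (c • f) w, AEEqFun.coeFn_smul c f,
      AEEqFun.coeFn_smul c (f * w), AEEqFun.coeFn_mul f w] with s h1 h2 h3 h4
    simp [h1, h2, h3, h4, mul_assoc]

theorem coeFn_mulWeight (ω : Weight μ) (f : G →ₘ[μ] ℂ) :
    mulWeight ω f =ᵐ[μ] fun s => f s * (ω s : ℂ) := by
  filter_upwards [AEEqFun.coeFn_mul f (AEEqFun.mk (fun s => (ω s : ℂ)) ω.aestronglyMeasurable),
    AEEqFun.coeFn_mk (fun s => (ω s : ℂ)) ω.aestronglyMeasurable] with s h1 h2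
  change (f * AEEqFun.mk (fun s => (ω s : ℂ)) ω.aestronglyMeasurable : G →ₘ[μ] ℂ) s = _
  rw [h1, Pi.mul_apply, h2]

theorem mulWeight_injective (ω : Weight μ) : Function.Injective (mulWeight ω) := by
  intro f g h
  refine AEEqFun.ext ?_
  have h' : mulWeight ω f =ᵐ[μ] mulWeight ω g := by rw [h]
  filter_upwards [h', coeFn_mulWeight ω f, coeFn_mulWeight ω g] with s h1 h2 h3
  rw [h2, h3] at h1
  exact mul_right_cancel₀ (by exact_mod_cast (ω.pos s).ne') h1

/-- The weighted Orlicz space `L^Φ_ω(G) = {f : f ω ∈ L^Φ(G)}`. -/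
def weightedOrlicz (Y : YoungPair) (ω : Weight μ) : Submodule ℂ (G →ₘ[μ] ℂ) :=
  (orlicz Y μ).comap (mulWeight ω)

/-- The map `f ↦ f ω` from `L^Φ_ω(G)` to `L^Φ(G)`. -/
def toOrlicz (Y : YoungPair) (ω : Weight μ) : weightedOrlicz Y ω →ₗ[ℂ] orlicz Y μ :=
  (mulWeight ω).restrict fun _ hf => hf

theorem toOrlicz_injective (Y : YoungPair) (ω : Weight μ) :
    Function.Injective (toOrlicz Y ω) := fun _ _ h =>
  Subtype.ext (mulWeight_injective ω (congrArg Subtype.val h))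

/-- `L^Φ_ω(G)` carries the norm `‖f‖_{Φ,ω} = ‖f ω‖_Φ`. -/
instance instNormedAddCommGroupWeighted (Y : YoungPair) (ω : Weight μ) :
    NormedAddCommGroup (weightedOrlicz Y ω) :=
  NormedAddCommGroup.induced (weightedOrlicz Y ω) (orlicz Y μ) (toOrlicz Y ω)
    (toOrlicz_injective Y ω)

instance instNormedSpaceWeighted (Y : YoungPair) (ω : Weight μ) :
    NormedSpace ℂ (weightedOrlicz Y ω) :=
  NormedSpace.induced ℂ (weightedOrlicz Y ω) (orlicz Y μ) (toOrlicz Y ω)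

/-- `S^Φ_ω(G) = {f : f ω ∈ S^Φ(G)}`, a subspace of `L^Φ_ω(G)` (with the norm of `L^Φ_ω(G)`). -/
def weightedOrliczS (Y : YoungPair) (ω : Weight μ) : Submodule ℂ (weightedOrlicz Y ω) :=
  (orliczS Y μ).comap (toOrlicz Y ω)

end Weighted

/-! ### Algebras with bounded multiplication and weak amenability -/

/-- A bounded (not necessarily contractive) associative bilinear multiplication on a complex
normed space. -/
structure BoundedMul (A : Type*) [NormedAddCommGroup A] [NormedSpace ℂ A] where
  mul : A →L[ℂ] A →L[ℂ] A
  assoc : ∀ a b c, mul (mul a b) c = mul a (mul b c)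

namespace BoundedMul

variable {A : Type*} [NormedAddCommGroup A] [NormedSpace ℂ A] (m : BoundedMul A)

/-- The left module action `(a · φ)(c) = φ(c a)` of `A` on `A*`. -/
def dualLeft (a : A) (φ : A →L[ℂ] ℂ) : A →L[ℂ] ℂ := φ.comp (m.mul.flip a)

/-- The right module action `(φ · a)(c) = φ(a c)` of `A` on `A*`. -/
def dualRight (φ : A →L[ℂ] ℂ) (a : A) : A →L[ℂ] ℂ := φ.comp (m.mul a)

/-- `D : A → A*` is a derivation: `D(ab) = a · D(b) + D(a) · b`. -/
def IsDerivation (D : A →L[ℂ] (A →L[ℂ] ℂ)) : Prop :=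
  ∀ a b, D (m.mul a b) = m.dualLeft a (D b) + m.dualRight (D a) b

/-- `D : A → A*` is inner: `D(a) = a · φ - φ · a` for some `φ ∈ A*`. -/
def IsInner (D : A →L[ℂ] (A →L[ℂ] ℂ)) : Prop :=
  ∃ φ : A →L[ℂ] ℂ, ∀ a, D a = m.dualLeft a φ - m.dualRight φ a

/-- Every bounded derivation `A → A*` is inner. -/
def IsWeaklyAmenable : Prop :=
  ∀ D : A →L[ℂ] (A →L[ℂ] ℂ), m.IsDerivation D → m.IsInner D

/-- The multiplication `m` on the space `A` of (classes of) functions on `G` is convolution: for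
all `f, g ∈ A` the integral `(f * g)(x) = ∫ f(t) g(x - t) dt` converges absolutely for almost every
`x`, and `m` sends `(f, g)` to the class of `f * g`. The map `ι` is the inclusion of `A` into the
space of all classes of measurable functions. -/
def IsConvolution {G : Type*} [AddCommGroup G] [MeasurableSpace G] {μ : Measure G}
    (ι : A → (G →ₘ[μ] ℂ)) : Prop :=
  ∀ f g : A,
    (∀ᵐ x ∂μ, ConvolutionExistsAt (ι f) (ι g) x (ContinuousLinearMap.mul ℂ ℂ) μ) ∧
      ι (m.mul f g) =ᵐ[μ] (ι f) ⋆[ContinuousLinearMap.mul ℂ ℂ, μ] (ι g)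

end BoundedMul

section Algebra

variable {G : Type*} [AddCommGroup G] [TopologicalSpace G] [MeasurableSpace G] {μ : Measure G}

/-- `L^Φ_ω(G)` is a Banach algebra under convolution. -/
def IsWeightedOrliczAlgebra (Y : YoungPair) (ω : Weight μ) : Prop :=
  ∃ m : BoundedMul (weightedOrlicz Y ω),
    m.IsConvolution (fun f => (f : G →ₘ[μ] ℂ))

/-- `S^Φ_ω(G)` is an algebra under convolution (with bounded multiplication), and this algebra is
weakly amenable. The multiplication is unique, being given by convolution. -/
def IsWeaklyAmenableS (Y : YoungPair) (ω : Weight μ) : Prop :=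
  ∃ m : BoundedMul (weightedOrliczS Y ω),
    m.IsConvolution (fun f => ((f : weightedOrlicz Y ω) : G →ₘ[μ] ℂ)) ∧ m.IsWeaklyAmenable

end Algebra

end WeightedOrlicz

end

/-!
Compactly supported continuous functions embed densely in `A = S^Φ_ω(G)`: the weight is bounded on
compact sets by Steinhaus' theorem, and a bounded function that is small in `L¹` is small in the
Orlicz norm. Let `D : A → A*` be a bounded derivation, and let `f`, `g`, `c` be compactly supported
and continuous. Expanding `D(τ_t (f * g))(τ_{-t} c)` in two ways, with the translation `τ_t` put on
`f` or on `g`, shows that the defect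

  `t ↦ D(τ_t f)(τ_{-t} (g * c)) - D(f)(g * c)`

is additive in `t`. It is continuous and bounded by a multiple of `ω(t) ω(-t)`, so it vanishes by
hypothesis. Hence `D` commutes with translations, and therefore with convolutions:
`D(h * f)(k) = D(f)(h * k)` for `k = g * c`. Comparing with the derivation identity
`D(h * f)(k) = D(f)(k * h) + D(h)(f * k)` leaves `D(h)(f * g * c) = 0`, and an approximate identity
together with density gives `D = 0`.
-/

namespace WeightedOrlicz

/-! ### Estimates in Orlicz spaces -/

section Estimates

variable {X : Type*} [MeasurableSpace X] {Y : YoungPair} {μ : Measure X}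

theorem nnnorm_coe_nnreal (r : ℝ≥0) : ‖(r : ℂ)‖₊ = r := by
  rw [Complex.nnnorm_real, NNReal.nnnorm_eq]

theorem IsYoungFunction.mul_le_mul {Φ : ℝ≥0 → ℝ≥0} (h : IsYoungFunction Φ) {x M : ℝ≥0}
    (hx : x ≤ M) : M * Φ x ≤ x * Φ M := by
  rcases eq_or_ne M 0 with rfl | hM
  · simp
  have hchord := h.convex.2 (Set.mem_univ M) (Set.mem_univ 0) (zero_le (a := x / M))
    (zero_le (a := 1 - x / M)) (add_tsub_cancel_of_le (div_le_one_of_le₀ hx zero_le))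
  simp only [smul_eq_mul, mul_zero, add_zero, h.map_zero, div_mul_cancel₀ _ hM] at hchord
  calc M * Φ x ≤ M * (x / M * Φ M) := by gcongr
    _ = x * Φ M := by field_simp

theorem lintegral_enorm_mul_le_orliczENorm (f : X →ₘ[μ] ℂ) {v : X →ₘ[μ] ℂ}
    (hv : modular Y.Ψ μ v ≤ 1) : ∫⁻ s, ‖f s * v s‖ₑ ∂μ ≤ orliczENorm Y f :=
  le_iSup₂ (f := fun (v : X →ₘ[μ] ℂ) (_ : modular Y.Ψ μ v ≤ 1) => ∫⁻ s, ‖f s * v s‖ₑ ∂μ) v hv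

theorem orliczENorm_le_mul {f g : X →ₘ[μ] ℂ} (c : ℝ≥0)
    (h : ∀ᵐ s ∂μ, ‖f s‖₊ ≤ c * ‖g s‖₊) : orliczENorm Y f ≤ c * orliczENorm Y g := by
  refine iSup₂_le fun v hv => ?_
  calc ∫⁻ s, ‖f s * v s‖ₑ ∂μ
      ≤ ∫⁻ s, c * ‖g s * v s‖ₑ ∂μ := by
        refine lintegral_mono_ae (h.mono fun s hs => ?_)
        rw [enorm_mul, enorm_mul, ← mul_assoc]
        gcongr
        rw [enorm_eq_nnnorm, enorm_eq_nnnorm]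
        exact_mod_cast hs
    _ = c * ∫⁻ s, ‖g s * v s‖ₑ ∂μ := lintegral_const_mul' _ _ ENNReal.coe_ne_top
    _ ≤ c * orliczENorm Y g := by
        gcongr
        exact lintegral_enorm_mul_le_orliczENorm g hv

theorem orliczENorm_compMeasurePreserving_le (f : X →ₘ[μ] ℂ) (e : X ≃ᵐ X)
    (he : MeasurePreserving e μ μ) :
    orliczENorm Y (f.compMeasurePreserving e he) ≤ orliczENorm Y f := by
  refine iSup₂_le fun v hv => ?_
  have he' : MeasurePreserving e.symm μ μ := he.symm e
  have hcomp := v.coeFn_compMeasurePreserving he'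
  have hmod : modular Y.Ψ μ (v.compMeasurePreserving e.symm he') = modular Y.Ψ μ v := by
    rw [modular, modular,
      ← he'.lintegral_comp_emb e.symm.measurableEmbedding fun s => (Y.Ψ ‖v s‖₊ : ℝ≥0∞)]
    exact lintegral_congr_ae (hcomp.mono fun s hs => by simp only [hs, Function.comp_apply])
  calc ∫⁻ s, ‖f.compMeasurePreserving e he s * v s‖ₑ ∂μ
      = ∫⁻ s, ‖f (e s) * v s‖ₑ ∂μ :=
        lintegral_congr_ae ((f.coeFn_compMeasurePreserving he).mono fun s hs => by
          simp only [hs, Function.comp_apply])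
    _ = ∫⁻ s, ‖f s * v (e.symm s)‖ₑ ∂μ := by
        rw [← he'.lintegral_comp_emb e.symm.measurableEmbedding]
        simp only [MeasurableEquiv.apply_symm_apply]
    _ = ∫⁻ s, ‖f s * v.compMeasurePreserving e.symm he' s‖ₑ ∂μ :=
        lintegral_congr_ae (hcomp.mono fun s hs => by simp only [hs, Function.comp_apply])
    _ ≤ orliczENorm Y f := lintegral_enorm_mul_le_orliczENorm f (hmod.le.trans hv)

theorem mul_orliczENorm_le (f : X →ₘ[μ] ℂ) (α : ℝ≥0) :
    α * orliczENorm Y f ≤ modular Y.Φ μ (fun s => (α : ℂ) * f s) + 1 := by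
  simp only [orliczENorm, ENNReal.mul_iSup]
  refine iSup₂_le fun v hv => ?_
  have hmeas : Measurable (fun s => (Y.Φ ‖(α : ℂ) * f s‖₊ : ℝ≥0∞)) :=
    (Y.young_left.continuous.measurable.comp
      (f.measurable.const_mul (α : ℂ)).nnnorm).coe_nnreal_ennreal
  calc α * ∫⁻ s, ‖f s * v s‖ₑ ∂μ
      = ∫⁻ s, (α : ℝ≥0∞) * ‖f s * v s‖ₑ ∂μ := (lintegral_const_mul' _ _ ENNReal.coe_ne_top).symm
    _ ≤ ∫⁻ s, ((Y.Φ ‖(α : ℂ) * f s‖₊ : ℝ≥0∞) + (Y.Ψ ‖v s‖₊ : ℝ≥0∞)) ∂μ := by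
        refine lintegral_mono fun s => ?_
        have h := Y.young_ineq ‖(α : ℂ) * f s‖₊ ‖v s‖₊
        simp only [nnnorm_mul, nnnorm_coe_nnreal, mul_assoc] at h
        simp only [enorm_eq_nnnorm, nnnorm_mul, nnnorm_coe_nnreal]
        exact_mod_cast h
    _ = modular Y.Φ μ (fun s => (α : ℂ) * f s) + modular Y.Ψ μ v := lintegral_add_left hmeas _
    _ ≤ modular Y.Φ μ (fun s => (α : ℂ) * f s) + 1 := by gcongr

theorem mul_modular_le {f : X → ℂ} {M α : ℝ≥0} (hα : 0 < α) (hM : ∀ᵐ s ∂μ, ‖f s‖₊ ≤ M) :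
    M * modular Y.Φ μ (fun s => (α : ℂ) * f s) ≤ Y.Φ (α * M) * ∫⁻ s, ‖f s‖ₑ ∂μ := by
  rw [modular, ← lintegral_const_mul' _ _ ENNReal.coe_ne_top,
    ← lintegral_const_mul' _ _ ENNReal.coe_ne_top]
  refine lintegral_mono_ae (hM.mono fun s hs => ?_)
  have h := Y.young_left.mul_le_mul (mul_le_mul_right hs α)
  rw [mul_assoc, mul_assoc] at h
  rw [nnnorm_mul, nnnorm_coe_nnreal, enorm_eq_nnnorm, mul_comm (Y.Φ (α * M) : ℝ≥0∞)]
  exact_mod_cast le_of_mul_le_mul_left h hα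

theorem exists_orliczENorm_le (Y : YoungPair) (μ : Measure X) (M : ℝ≥0) {ε : ℝ≥0} (hε : 0 < ε) :
    ∃ δ : ℝ≥0, 0 < δ ∧ ∀ f : X →ₘ[μ] ℂ, (∀ᵐ s ∂μ, ‖f s‖₊ ≤ M) →
      ∫⁻ s, ‖f s‖ₑ ∂μ ≤ δ → orliczENorm Y f ≤ ε := by
  let N : ℝ≥0 := M + 1
  let α : ℝ≥0 := 2 / ε
  have hα : 0 < α := by positivity
  refine ⟨N / (Y.Φ (α * N) + 1), by positivity, fun f hM hδ => ?_⟩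
  have hmodular : modular Y.Φ μ (fun s => (α : ℂ) * f s) ≤ 1 := by
    have hN : (N : ℝ≥0∞) ≠ 0 := by simp [N]
    refine (ENNReal.mul_le_mul_iff_right hN ENNReal.coe_ne_top).1 ?_
    calc N * modular Y.Φ μ (fun s => (α : ℂ) * f s)
        ≤ Y.Φ (α * N) * ∫⁻ s, ‖f s‖ₑ ∂μ :=
          mul_modular_le hα (hM.mono fun s hs => hs.trans (le_add_of_nonneg_right zero_le))
      _ ≤ Y.Φ (α * N) * (N / (Y.Φ (α * N) + 1) : ℝ≥0) := by gcongr
      _ ≤ N * 1 := by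
        norm_cast
        rw [mul_one, mul_div_assoc', div_le_iff₀ (by positivity), mul_comm]
        gcongr
        exact le_self_add
  have hscaled : (α : ℝ≥0∞) * orliczENorm Y f ≤ α * ε := by
    refine (mul_orliczENorm_le f α).trans ((add_le_add_left hmodular 1).trans (le_of_eq ?_))
    norm_cast
    rw [div_mul_cancel₀ _ hε.ne']
    norm_num
  exact (ENNReal.mul_le_mul_iff_right (by simpa using hα.ne') ENNReal.coe_ne_top).1 hscaled

theorem mem_orlicz_of_bounded {f : X →ₘ[μ] ℂ} {M : ℝ≥0} (hM : ∀ᵐ s ∂μ, ‖f s‖₊ ≤ M)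
    (hf : ∫⁻ s, ‖f s‖ₑ ∂μ < ∞) : f ∈ orlicz Y μ := by
  have hmodular := mul_modular_le (Y := Y) (M := M + 1) one_pos
    (hM.mono fun s hs => hs.trans (le_add_of_nonneg_right zero_le))
  refine ⟨1, one_pos, ENNReal.lt_top_of_mul_ne_top_right ?_ (by simp : ((M + 1 : ℝ≥0) : ℝ≥0∞) ≠ 0)⟩
  exact (hmodular.trans_lt (ENNReal.mul_lt_top ENNReal.coe_lt_top hf)).ne

theorem norm_orlicz_le_mul {f g : orlicz Y μ} {c : ℝ≥0}
    (h : orliczENorm Y (f : X →ₘ[μ] ℂ) ≤ c * orliczENorm Y (g : X →ₘ[μ] ℂ)) :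
    ‖f‖ ≤ c * ‖g‖ := by
  rw [norm_orlicz_def, norm_orlicz_def, ← ENNReal.coe_toReal c, ← ENNReal.toReal_mul]
  exact ENNReal.toReal_mono
    (ENNReal.mul_lt_top ENNReal.coe_lt_top (orliczENorm_lt_top g.2)).ne h

end Estimates

/-! ### Functions with class in a closed subspace of an Orlicz space -/

section HasClassIn

variable {X : Type*} [MeasurableSpace X] {Y : YoungPair} {μ : Measure X}

/-- The almost-everywhere class of `f` lies in the subspace `V` of `L^Φ(μ)`. Closed subspaces are
studied through functions, on which pointwise operations are literal. -/
def HasClassIn (V : Submodule ℂ (orlicz Y μ)) (f : X → ℂ) : Prop :=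
  ∃ g ∈ V, (g : X →ₘ[μ] ℂ) =ᵐ[μ] f

namespace HasClassIn

variable {V : Submodule ℂ (orlicz Y μ)} {f g : X → ℂ}

theorem congr_ae (hf : HasClassIn V f) (h : f =ᵐ[μ] g) : HasClassIn V g :=
  let ⟨f', hf', hae⟩ := hf
  ⟨f', hf', hae.trans h⟩

theorem add (hf : HasClassIn V f) (hg : HasClassIn V g) : HasClassIn V (f + g) := by
  obtain ⟨f', hf', hf⟩ := hf
  obtain ⟨g', hg', hg⟩ := hg
  exact ⟨f' + g', V.add_mem hf' hg', (AEEqFun.coeFn_add _ _).trans (hf.add hg)⟩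

theorem const_smul (c : ℂ) (hf : HasClassIn V f) : HasClassIn V (c • f) := by
  obtain ⟨f', hf', hf⟩ := hf
  exact ⟨c • f', V.smul_mem c hf', (AEEqFun.coeFn_smul _ _).trans (hf.const_smul c)⟩

theorem mem {f : orlicz Y μ} (hf : HasClassIn V (f : X →ₘ[μ] ℂ)) : f ∈ V := by
  obtain ⟨g, hg, hae⟩ := hf
  rwa [← Subtype.ext (AEEqFun.ext hae)]

theorem of_bounded {M : ℝ≥0} (hf : AEStronglyMeasurable f μ) (hM : ∀ᵐ s ∂μ, ‖f s‖₊ ≤ M)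
    (hfin : ∫⁻ s, ‖f s‖ₑ ∂μ < ∞) : HasClassIn (⊤ : Submodule ℂ (orlicz Y μ)) f := by
  have hae : AEEqFun.mk f hf =ᵐ[μ] f := AEEqFun.coeFn_mk f hf
  refine ⟨⟨AEEqFun.mk f hf, mem_orlicz_of_bounded (M := M) ?_ ?_⟩, Submodule.mem_top, hae⟩
  · filter_upwards [hM, hae] with s hs h
    rwa [h]
  · rwa [lintegral_congr_ae (hae.mono fun s h => by rw [h])]

theorem of_forall_exists_lintegral_sub_le (hV : IsClosed (V : Set (orlicz Y μ))) (M : ℝ≥0)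
    (hf : AEStronglyMeasurable f μ)
    (h : ∀ δ : ℝ≥0, 0 < δ → ∃ g, HasClassIn V g ∧ (∀ᵐ s ∂μ, ‖f s - g s‖₊ ≤ M) ∧
      ∫⁻ s, ‖f s - g s‖ₑ ∂μ ≤ δ) : HasClassIn V f := by
  have hfmem : HasClassIn (⊤ : Submodule ℂ (orlicz Y μ)) f := by
    obtain ⟨_, ⟨g, -, hg⟩, hM, hδ⟩ := h 1 one_pos
    have hsub := of_bounded (Y := Y) (hf.sub (g.1.aestronglyMeasurable.congr hg)) hM
      (hδ.trans_lt ENNReal.coe_lt_top)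
    exact (hsub.add ⟨g, Submodule.mem_top, hg⟩).congr_ae (by simp)
  obtain ⟨f', -, hf'⟩ := hfmem
  refine ⟨f', ?_, hf'⟩
  rw [← SetLike.mem_coe, ← hV.closure_eq, Metric.mem_closure_iff]
  intro ε hε
  lift ε to ℝ≥0 using hε.le
  have hε' : 0 < ε / 2 := half_pos (by exact_mod_cast hε)
  obtain ⟨δ, hδ, hsmall⟩ := exists_orliczENorm_le Y μ M hε'
  obtain ⟨_, ⟨g, hgV, hg⟩, hM, hgδ⟩ := h δ hδ
  have hae : ((f' - g : orlicz Y μ) : X →ₘ[μ] ℂ) =ᵐ[μ] fun s => f s - _ :=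
    (AEEqFun.coeFn_sub _ _).trans (hf'.sub hg)
  refine ⟨g, hgV, ?_⟩
  rw [dist_eq_norm, norm_orlicz_def]
  refine (ENNReal.toReal_le_coe_of_le_coe (hsmall _ ?_ ?_)).trans_lt (by
    exact_mod_cast half_lt_self (show 0 < ε by exact_mod_cast hε))
  · filter_upwards [hae, hM] with s h hs
    rwa [h]
  · rwa [lintegral_congr_ae (hae.mono fun s h => by rw [h])]

theorem of_tendsto {K : Set X} (hV : IsClosed (V : Set (orlicz Y μ))) (M : ℝ≥0)
    (hK : μ K ≠ ∞) (hKm : MeasurableSet K) (hf : AEStronglyMeasurable f μ) {g : ℕ → X → ℂ}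
    (hg : ∀ n, HasClassIn V (g n)) (hM : ∀ n, ∀ᵐ s ∂μ, ‖f s - g n s‖₊ ≤ K.indicator (fun _ => M) s)
    (hlim : ∀ᵐ s ∂μ, Tendsto (fun n => g n s) atTop (𝓝 (f s))) : HasClassIn V f := by
  have hgm : ∀ n, AEStronglyMeasurable (g n) μ := fun n =>
    let ⟨g', _, hae⟩ := hg n
    g'.1.aestronglyMeasurable.congr hae
  have hL1 : Tendsto (fun n => ∫⁻ s, ‖f s - g n s‖ₑ ∂μ) atTop (𝓝 0) := by
    rw [← lintegral_zero (μ := μ)]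
    refine tendsto_lintegral_of_dominated_convergence' (K.indicator fun _ => (M : ℝ≥0∞))
      (fun n => (hf.sub (hgm n)).enorm) (fun n => (hM n).mono fun s hs => ?_) ?_ ?_
    · by_cases hsK : s ∈ K <;> simpa [hsK, enorm_eq_nnnorm] using hs
    · rw [lintegral_indicator hKm, setLIntegral_const]
      exact ENNReal.mul_ne_top ENNReal.coe_ne_top hK
    · filter_upwards [hlim] with s hs
      simpa using ((tendsto_const_nhds (x := f s)).sub hs).enorm
  refine of_forall_exists_lintegral_sub_le hV M hf fun δ hδ => ?_
  obtain ⟨n, hn⟩ := (hL1.eventually (ge_mem_nhds (ENNReal.coe_pos.2 hδ))).exists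
  exact ⟨g n, hg n, (hM n).mono fun s hs =>
    hs.trans (Set.indicator_le_self' (fun _ _ => zero_le) s), hn⟩

theorem of_forall_exists_eqOn_compl (hV : IsClosed (V : Set (orlicz Y μ))) (M : ℝ≥0)
    (hf : AEStronglyMeasurable f μ)
    (h : ∀ δ : ℝ≥0∞, δ ≠ 0 → ∃ g, HasClassIn V g ∧ (∀ s, ‖f s - g s‖₊ ≤ M) ∧
      ∃ N, MeasurableSet N ∧ μ N ≤ δ ∧ Set.EqOn f g Nᶜ) : HasClassIn V f := by
  refine of_forall_exists_lintegral_sub_le hV M hf fun δ hδ => ?_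
  obtain ⟨g, hg, hM, N, hN, hNδ, hfg⟩ := h (δ / M) (by simp [hδ.ne'])
  refine ⟨g, hg, Eventually.of_forall hM, ?_⟩
  calc ∫⁻ s, ‖f s - g s‖ₑ ∂μ ≤ ∫⁻ s, N.indicator (fun _ => (M : ℝ≥0∞)) s ∂μ := by
        refine lintegral_mono fun s => ?_
        by_cases hs : s ∈ N
        · simpa [hs, enorm_eq_nnnorm] using hM s
        · simp [hs, hfg hs]
    _ = M * μ N := by rw [lintegral_indicator hN, setLIntegral_const]
    _ ≤ M * (δ / M) := by gcongr
    _ ≤ δ := ENNReal.mul_div_le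

theorem indicator_simpleFunc_mul {K : Set X} {u : X → ℂ}
    (h : ∀ E ⊆ K, MeasurableSet E → HasClassIn V (E.indicator u)) (hK : MeasurableSet K)
    (g : SimpleFunc X ℂ) : HasClassIn V (K.indicator (g * u)) := by
  induction g using SimpleFunc.induction with
  | const c hE =>
    rename_i E
    convert (h (K ∩ E) Set.inter_subset_left (hK.inter hE)).const_smul c using 1
    ext s
    by_cases hsK : s ∈ K <;> by_cases hsE : s ∈ E <;> simp [hsK, hsE]
  | add _ hf hg =>
    convert hf.add hg using 1
    rw [SimpleFunc.coe_add, add_mul, Set.indicator_add']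

theorem indicator_mul {K : Set X} {u : X → ℂ} {W M : ℝ≥0} (hV : IsClosed (V : Set (orlicz Y μ)))
    (h : ∀ E ⊆ K, MeasurableSet E → HasClassIn V (E.indicator u)) (hK : MeasurableSet K)
    (hKfin : μ K ≠ ∞) (hu : AEStronglyMeasurable u μ) (hW : ∀ s ∈ K, ‖u s‖₊ ≤ W)
    (hf : AEStronglyMeasurable f μ) (hM : ∀ᵐ s ∂μ, ‖f s‖₊ ≤ M) :
    HasClassIn V (K.indicator (f * u)) := by
  let f' := hf.mk f
  have hf' : StronglyMeasurable f' := hf.stronglyMeasurable_mk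
  have hff' : f =ᵐ[μ] f' := hf.ae_eq_mk
  have hM' : ∀ᵐ s ∂μ, ‖f' s‖ ≤ M := by
    filter_upwards [hff', hM] with s hs h
    rw [← hs]
    exact_mod_cast h
  refine of_tendsto (K := K) hV ((M + M) * W) hKfin hK ((hf.mul hu).indicator hK)
    (fun n => indicator_simpleFunc_mul h hK (hf'.approxBounded M n)) (fun n => ?_) ?_
  · filter_upwards [hM] with s hMs
    by_cases hsK : s ∈ K
    · simp only [Set.indicator_of_mem hsK, Pi.mul_apply, ← sub_mul, nnnorm_mul]
      gcongr
      · exact (nnnorm_sub_le _ _).trans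
          (add_le_add hMs (hf'.norm_approxBounded_le M.2 n s))
      · exact hW s hsK
    · simp [hsK]
  · filter_upwards [hff', hf'.tendsto_approxBounded_ae hM'] with s hs hlim
    by_cases hsK : s ∈ K
    · simpa [hsK, hs] using hlim.mul_const (u s)
    · simp [hsK]

end HasClassIn

theorem exists_pos_le_nnnorm_simpleFunc {E : Type*} [NormedAddCommGroup E]
    (g : SimpleFunc X E) :
    ∃ c : ℝ≥0, 0 < c ∧ ∀ s, g s ≠ 0 → c ≤ ‖g s‖₊ := by
  classical
  have hne : ∀ {s}, g s ≠ 0 → g s ∈ g.range.filter (· ≠ 0) := fun {s} hs =>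
    Finset.mem_filter.2 ⟨g.mem_range_self s, hs⟩
  rcases (g.range.filter (· ≠ 0)).eq_empty_or_nonempty with hempty | hnonempty
  · refine ⟨1, one_pos, fun s hs => ?_⟩
    have h := hne hs
    simp [hempty] at h
  · obtain ⟨z, hz, hzmin⟩ := Finset.exists_min_image _ (fun z : E => ‖z‖₊) hnonempty
    exact ⟨‖z‖₊, nnnorm_pos.2 (Finset.mem_filter.1 hz).2, fun s hs => hzmin _ (hne hs)⟩

theorem measure_lt_top_of_mem_orlicz {f : X →ₘ[μ] ℂ} (hf : f ∈ orlicz Y μ) {N : Set X} {c : ℝ≥0}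
    (hc : 0 < c) (h : ∀ᵐ s ∂μ, s ∈ N → c ≤ ‖f s‖₊) : μ N < ∞ := by
  obtain ⟨α, hα, hm⟩ := hf
  have hΦ : (Y.Φ (α * c) : ℝ≥0∞) ≠ 0 := by
    rw [ENNReal.coe_ne_zero, ← Y.young_left.map_zero]
    exact (Y.young_left.strictMono (mul_pos hα hc)).ne'
  have hmeas : Measurable (fun s => (Y.Φ ‖(α : ℂ) * f s‖₊ : ℝ≥0∞)) :=
    (Y.young_left.continuous.measurable.comp
      (f.measurable.const_mul (α : ℂ)).nnnorm).coe_nnreal_ennreal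
  calc μ N ≤ μ {s | (Y.Φ (α * c) : ℝ≥0∞) ≤ Y.Φ ‖(α : ℂ) * f s‖₊} := by
        refine measure_mono_ae (h.mono fun s hs hsN => ENNReal.coe_le_coe.2 ?_)
        refine Y.young_left.strictMono.monotone ?_
        rw [nnnorm_mul, nnnorm_coe_nnreal]
        gcongr
        exact hs hsN
    _ ≤ modular Y.Φ μ (fun s => (α : ℂ) * f s) / Y.Φ (α * c) :=
        meas_ge_le_lintegral_div hmeas.aemeasurable hΦ ENNReal.coe_ne_top
    _ < ∞ := ENNReal.div_lt_top hm.ne hΦ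

theorem exists_simpleFunc_of_mem_stepFunctions {f : orlicz Y μ} (hf : f ∈ stepFunctions Y μ) :
    ∃ g : SimpleFunc X ℂ, μ (Function.support g) < ∞ ∧ (f : X →ₘ[μ] ℂ) =ᵐ[μ] g := by
  obtain ⟨g, hg⟩ := hf
  obtain ⟨c, hc, hcg⟩ := exists_pos_le_nnnorm_simpleFunc g
  refine ⟨g, measure_lt_top_of_mem_orlicz f.2 hc ?_, hg⟩
  filter_upwards [hg] with s hs hsN
  rw [hs]
  exact hcg s hsN

theorem stepFunctions_le {V : Submodule ℂ (orlicz Y μ)}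
    (h : ∀ E, MeasurableSet E → μ E ≠ ∞ → HasClassIn V (E.indicator 1)) :
    stepFunctions Y μ ≤ V := by
  intro f hf
  obtain ⟨g, hgfin, hfg⟩ := exists_simpleFunc_of_mem_stepFunctions hf
  have hg := HasClassIn.indicator_simpleFunc_mul (V := V) (u := 1)
    (fun E hE hEm => h E hEm (ne_top_of_le_ne_top hgfin.ne (measure_mono hE)))
    g.measurableSet_support g
  rw [mul_one, Set.indicator_support] at hg
  exact HasClassIn.mem (hg.congr_ae hfg.symm)

theorem hasClassIn_orliczS_indicator_one {E : Set X} (hE : MeasurableSet E) (hfin : μ E ≠ ∞) :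
    HasClassIn (orliczS Y μ) (E.indicator 1) := by
  have hbound : ∀ s, ‖E.indicator (1 : X → ℂ) s‖₊ ≤ 1 := fun s =>
    (norm_indicator_le_norm_self _ _).trans (by simp)
  obtain ⟨f, -, hf⟩ := HasClassIn.of_bounded (Y := Y)
    (stronglyMeasurable_one.indicator hE).aestronglyMeasurable
    (Eventually.of_forall hbound) (by
      simpa [enorm_indicator_eq_indicator_enorm, lintegral_indicator hE] using hfin.lt_top)
  refine ⟨f, Submodule.le_topologicalClosure _
    ⟨(SimpleFunc.const X 1).restrict E, hf.trans (.of_forall fun s => ?_)⟩, hf⟩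
  simp [SimpleFunc.restrict_apply _ hE]

theorem hasClassIn_orliczS_of_bounded {f : X → ℂ} {K : Set X} (hK : MeasurableSet K)
    (hfin : μ K ≠ ∞) (hf : AEStronglyMeasurable f μ) {M : ℝ≥0} (hM : ∀ᵐ s ∂μ, ‖f s‖₊ ≤ M)
    (hfK : ∀ s ∉ K, f s = 0) : HasClassIn (orliczS Y μ) f := by
  have h := HasClassIn.indicator_mul (Submodule.isClosed_topologicalClosure (stepFunctions Y μ))
    (u := 1) (W := 1)
    (fun E hE hEm => hasClassIn_orliczS_indicator_one hEm
      (ne_top_of_le_ne_top hfin (measure_mono hE))) hK hfin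
    stronglyMeasurable_one.aestronglyMeasurable (by simp) hf hM
  rwa [mul_one, Set.indicator_eq_self.2 (Function.support_subset_iff'.2 hfK)] at h

end HasClassIn

/-! ### Density of compactly supported continuous functions -/

section Density

open scoped CompactlySupported

theorem exists_cc_eqOn_one {X : Type*} [TopologicalSpace X] [T2Space X] [LocallyCompactSpace X]
    {K U : Set X} (hK : IsCompact K) (hU : IsOpen U) (hKU : K ⊆ U) :
    ∃ χ : C_c(X, ℂ), Set.EqOn χ 1 K ∧ (∀ s ∉ U, χ s = 0) ∧ ∀ s, ‖χ s‖ ≤ 1 := by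
  obtain ⟨f, hfK, hf, hfU, hf01⟩ := exists_continuousMap_one_of_isCompact_subset_isOpen hK hU hKU
  obtain ⟨χ, hχ⟩ : ∃ χ : C_c(X, ℂ), ∀ s, χ s = (f s : ℂ) :=
    ⟨⟨⟨fun s => (f s : ℂ), Complex.continuous_ofReal.comp f.continuous⟩,
      HasCompactSupport.comp_left (g := Complex.ofReal) hf Complex.ofReal_zero⟩, fun _ => rfl⟩
  refine ⟨χ, fun s hs => ?_, fun s hs => ?_, fun s => ?_⟩
  · simp [hχ, hfK hs]
  · simp [hχ, image_eq_zero_of_notMem_tsupport (Set.notMem_subset hfU hs)]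
  · rw [hχ, Complex.norm_real, Real.norm_of_nonneg (hf01 s).1]
    exact (hf01 s).2

/-- A function on a topological space is bounded on every compact set. -/
def BoundedOnCompacts {X : Type*} [TopologicalSpace X] (u : X → ℂ) : Prop :=
  ∀ K, IsCompact K → ∃ W : ℝ≥0, ∀ s ∈ K, ‖u s‖₊ ≤ W

variable {X : Type*} [TopologicalSpace X] [MeasurableSpace X] [BorelSpace X] {Y : YoungPair}
  {μ : Measure X} [μ.Regular] {V : Submodule ℂ (orlicz Y μ)} {u : X → ℂ}

theorem HasClassIn.indicator_of_isCompact [T2Space X] {E : Set X} {W : ℝ≥0}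
    (hV : IsClosed (V : Set (orlicz Y μ))) (hu : AEStronglyMeasurable u μ)
    (hE : MeasurableSet E) (hfin : μ E ≠ ∞) (hW : ∀ s ∈ E, ‖u s‖₊ ≤ W)
    (h : ∀ K ⊆ E, IsCompact K → HasClassIn V (K.indicator u)) : HasClassIn V (E.indicator u) := by
  refine HasClassIn.of_forall_exists_eqOn_compl hV W (hu.indicator hE) fun δ hδ => ?_
  obtain ⟨K, hKE, hK, hEK⟩ := hE.exists_isCompact_sdiff_lt hfin hδ
  refine ⟨_, h K hKE hK, fun s => ?_, E \ K, hE.diff hK.measurableSet, hEK.le, fun s hs => ?_⟩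
  · by_cases hsK : s ∈ K
    · simp [hsK, hKE hsK]
    · by_cases hsE : s ∈ E
      · simpa [hsK, hsE] using hW s hsE
      · simp [hsK, hsE]
  · by_cases hsK : s ∈ K
    · simp [hsK, hKE hsK]
    · have hsE : s ∉ E := fun hsE => hs ⟨hsE, hsK⟩
      simp [hsK, hsE]

variable [T2Space X] [LocallyCompactSpace X]

theorem hasClassIn_indicator_of_isCompact (hV : IsClosed (V : Set (orlicz Y μ)))
    (hu : AEStronglyMeasurable u μ) (hbdd : BoundedOnCompacts u)
    (hcc : ∀ φ : C_c(X, ℂ), HasClassIn V (φ * u)) {K : Set X} (hK : IsCompact K) :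
    HasClassIn V (K.indicator u) := by
  obtain ⟨L, hL, hKL⟩ := exists_compact_superset hK
  obtain ⟨W, hW⟩ := hbdd L hL
  refine HasClassIn.of_forall_exists_eqOn_compl hV W (hu.indicator hK.measurableSet) fun δ hδ => ?_
  obtain ⟨U, hKU, hU, -, hUK⟩ :=
    hK.measurableSet.exists_isOpen_sdiff_lt (hK.measure_ne_top (μ := μ)) hδ
  obtain ⟨χ, hχK, hχU, hχ⟩ :=
    exists_cc_eqOn_one hK (hU.inter isOpen_interior) (Set.subset_inter hKU hKL)
  refine ⟨_, hcc χ, fun s => ?_, U \ K, hU.measurableSet.diff hK.measurableSet, hUK.le, ?_⟩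
  · by_cases hsK : s ∈ K
    · simp [hsK, hχK hsK]
    by_cases hsL : s ∈ L
    · simpa [hsK] using mul_le_mul' (show ‖χ s‖₊ ≤ 1 from hχ s) (hW s hsL)
    · simp [hsK, hχU s fun h => hsL (interior_subset h.2)]
  · intro s hs
    by_cases hsK : s ∈ K
    · simp [hsK, hχK hsK]
    · simp [hsK, hχU s fun h => hs ⟨h.1, hsK⟩]

theorem orliczS_le_of_forall_cc (hV : IsClosed (V : Set (orlicz Y μ)))
    (hu : AEStronglyMeasurable u μ) (hu0 : ∀ s, u s ≠ 0) (hbdd : BoundedOnCompacts u)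
    (hbdd_inv : BoundedOnCompacts u⁻¹) (hcc : ∀ φ : C_c(X, ℂ), HasClassIn V (φ * u)) :
    orliczS Y μ ≤ V := by
  refine Submodule.topologicalClosure_minimal _ (stepFunctions_le fun E hE hfin => ?_) hV
  refine HasClassIn.indicator_of_isCompact hV stronglyMeasurable_one.aestronglyMeasurable hE hfin
    (W := 1) (by simp) fun K _ hK => ?_
  obtain ⟨W, hW⟩ := hbdd K hK
  obtain ⟨W', hW'⟩ := hbdd_inv K hK
  have hsub : ∀ E ⊆ K, MeasurableSet E → HasClassIn V (E.indicator u) := fun E hEK hE =>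
    HasClassIn.indicator_of_isCompact hV hu hE
      (ne_top_of_le_ne_top (hK.measure_ne_top (μ := μ)) (measure_mono hEK))
      (fun s hs => hW s (hEK hs))
      fun _ _ => hasClassIn_indicator_of_isCompact hV hu hbdd hcc
  have hinv := HasClassIn.indicator_mul (f := K.indicator u⁻¹) (M := W') hV hsub hK.measurableSet
    hK.measure_ne_top hu hW (hu.inv₀.indicator hK.measurableSet)
    (.of_forall fun s => by
      by_cases hs : s ∈ K
      · simpa [hs] using hW' s hs
      · simp [hs])
  refine hinv.congr_ae (.of_forall fun s => ?_)
  by_cases hs : s ∈ K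
  · simp [hs, hu0 s]
  · simp [hs]

end Density

/-! ### Compactly supported continuous functions -/

section TendstoCc

open scoped CompactlySupported BoundedContinuousFunction

variable {α X : Type*} [TopologicalSpace X]

/-- Convergence in the inductive limit topology of `C_c(X)`: uniform convergence with all
differences supported in one compact set. -/
def TendstoCc (F : α → C_c(X, ℂ)) (l : Filter α) (φ : C_c(X, ℂ)) : Prop :=
  (∃ K, IsCompact K ∧ ∀ᶠ a in l, ∀ s ∉ K, F a s = φ s) ∧ TendstoUniformly (fun a s => F a s) φ l

variable {A : Type*} [NormedAddCommGroup A] [NormedSpace ℂ A]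

/-- Continuity of a linear map on `C_c(X)` for the inductive limit topology, expressed by bounds in
terms of the uniform norm on the functions vanishing off a given compact set. -/
def IsLocallyBounded (ι : C_c(X, ℂ) →ₗ[ℂ] A) : Prop :=
  ∀ K, IsCompact K → ∃ M : ℝ≥0, ∀ (φ : C_c(X, ℂ)) (ε : ℝ≥0),
    (∀ s, ‖φ s‖ ≤ ε) → (∀ s ∉ K, φ s = 0) → ‖ι φ‖ ≤ M * ε

variable {ι : C_c(X, ℂ) →ₗ[ℂ] A}

theorem IsLocallyBounded.tendsto (hι : IsLocallyBounded ι) {F : α → C_c(X, ℂ)} {l : Filter α}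
    {φ : C_c(X, ℂ)} (h : TendstoCc F l φ) : Tendsto (fun a => ι (F a)) l (𝓝 (ι φ)) := by
  obtain ⟨⟨K, hK, hFK⟩, hF⟩ := h
  obtain ⟨M, hM⟩ := hι K hK
  refine Metric.tendsto_nhds.2 fun ε hε => ?_
  obtain ⟨δ, hδ, hMδ⟩ := exists_pos_mul_lt hε (M : ℝ)
  filter_upwards [hFK, Metric.tendstoUniformly_iff.1 hF δ hδ] with a haK ha
  rw [dist_eq_norm, ← map_sub]
  refine (hM _ ⟨δ, hδ.le⟩ (fun s => ?_) fun s hs => ?_).trans_lt hMδ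
  · rw [CompactlySupportedContinuousMap.sub_apply, ← dist_eq_norm, dist_comm]
    exact (ha s).le
  · rw [CompactlySupportedContinuousMap.sub_apply, haK s hs, sub_self]

theorem IsLocallyBounded.comp {B : Type*} [NormedAddCommGroup B] [NormedSpace ℂ B]
    (hι : IsLocallyBounded ι) (T : A →L[ℂ] B) : IsLocallyBounded ((T : A →ₗ[ℂ] B) ∘ₗ ι) := by
  intro K hK
  obtain ⟨M, hM⟩ := hι K hK
  refine ⟨‖T‖₊ * M, fun φ ε hε hφ => (T.le_opNorm _).trans ?_⟩
  push_cast
  rw [mul_assoc]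
  gcongr
  exact hM φ ε hε hφ

/-- The inclusion of `C_c(X)` into the bounded continuous functions. -/
noncomputable def ccToBounded : C_c(X, ℂ) →ₗ[ℂ] X →ᵇ ℂ where
  toFun φ := φ.toBoundedContinuousFunction
  map_add' _ _ := rfl
  map_smul' _ _ := rfl

theorem isLocallyBounded_ccToBounded : IsLocallyBounded (ccToBounded (X := X)) := fun _ _ =>
  ⟨1, fun _ ε hε _ => by
    simpa using (BoundedContinuousFunction.norm_le ε.coe_nonneg).2 hε⟩

/-- The bounded continuous functions that vanish off `K`. -/
def boundedSupportedIn (K : Set X) : Submodule ℂ (X →ᵇ ℂ) where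
  carrier := {f | ∀ s ∉ K, f s = 0}
  zero_mem' _ _ := rfl
  add_mem' hf hg s hs := by simp [hf s hs, hg s hs]
  smul_mem' c f hf s hs := by simp [hf s hs]

theorem IsLocallyBounded.exists_clm_eq [R1Space X] {Λ : C_c(X, ℂ) →ₗ[ℂ] ℂ} (hΛ : IsLocallyBounded Λ)
    {K : Set X} (hK : IsCompact K) :
    ∃ T : (X →ᵇ ℂ) →L[ℂ] ℂ, ∀ φ : C_c(X, ℂ), (∀ s ∉ K, φ s = 0) → T (ccToBounded φ) = Λ φ := by
  obtain ⟨M, hM⟩ := hΛ K hK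
  let toCc : boundedSupportedIn K →ₗ[ℂ] C_c(X, ℂ) :=
    { toFun := fun f => ⟨f.1, HasCompactSupport.of_support_subset_isCompact hK fun s hs =>
        not_not.1 fun h => hs (f.2 s h)⟩
      map_add' := fun _ _ => rfl
      map_smul' := fun _ _ => rfl }
  obtain ⟨T, hT, -⟩ := exists_extension_norm_eq (boundedSupportedIn K)
    ((Λ ∘ₗ toCc).mkContinuous M fun f => hM _ ‖f‖₊ (fun s => f.1.norm_coe_le_norm s) f.2)
  exact ⟨T, fun φ hφ => hT ⟨ccToBounded φ, hφ⟩⟩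

end TendstoCc

section Translation

open scoped CompactlySupported Pointwise

variable {G : Type*} [AddCommGroup G] [TopologicalSpace G] [IsTopologicalAddGroup G]

/-- The translate `s ↦ φ (s - t)` of a compactly supported continuous function. -/
noncomputable def ccTranslate (t : G) (φ : C_c(G, ℂ)) : C_c(G, ℂ) where
  toFun s := φ (s - t)
  continuous_toFun := φ.continuous.comp (continuous_sub_right t)
  hasCompactSupport' := φ.hasCompactSupport.comp_homeomorph (Homeomorph.subRight t)

@[simp]
theorem ccTranslate_apply (t : G) (φ : C_c(G, ℂ)) (s : G) : ccTranslate t φ s = φ (s - t) := rfl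

theorem ccTranslate_add (s t : G) (φ : C_c(G, ℂ)) :
    ccTranslate (s + t) φ = ccTranslate s (ccTranslate t φ) := by
  ext x
  simp [sub_sub]

@[simp]
theorem ccTranslate_zero (φ : C_c(G, ℂ)) : ccTranslate 0 φ = φ := by
  ext x
  simp

theorem ccTranslate_neg_ccTranslate (t : G) (φ : C_c(G, ℂ)) :
    ccTranslate (-t) (ccTranslate t φ) = φ := by
  rw [← ccTranslate_add, neg_add_cancel, ccTranslate_zero]

theorem ccTranslate_ccTranslate_neg (t : G) (φ : C_c(G, ℂ)) :
    ccTranslate t (ccTranslate (-t) φ) = φ := by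
  rw [← ccTranslate_add, add_neg_cancel, ccTranslate_zero]

variable [LocallyCompactSpace G]

theorem tendstoCc_ccTranslate (φ : C_c(G, ℂ)) (t₀ : G) :
    TendstoCc (fun t => ccTranslate t φ) (𝓝 t₀) (ccTranslate t₀ φ) := by
  obtain ⟨N, hN, hN0⟩ := exists_compact_mem_nhds t₀
  have hK : IsCompact (tsupport φ + N) := φ.hasCompactSupport.isCompact.add hN
  have hvan : ∀ t ∈ N, ∀ s ∉ tsupport φ + N, ccTranslate t φ s = 0 := fun t ht s hs =>
    image_eq_zero_of_notMem_tsupport (f := φ) fun h => hs ⟨s - t, h, t, ht, sub_add_cancel s t⟩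
  have heq : ∀ t ∈ N, ∀ s ∉ tsupport φ + N, ccTranslate t φ s = ccTranslate t₀ φ s :=
    fun t ht s hs => (hvan t ht s hs).trans (hvan t₀ (mem_of_mem_nhds hN0) s hs).symm
  refine ⟨⟨_, hK, mem_of_superset hN0 heq⟩, Metric.tendstoUniformly_iff.2 fun ε hε => ?_⟩
  have hunif : ∀ᶠ t in 𝓝 t₀, ∀ s ∈ tsupport φ + N,
      dist (ccTranslate t₀ φ s) (ccTranslate t φ s) < ε := by
    refine hK.eventually_forall_of_forall_eventually fun s _ => ?_
    have hcont : Continuous fun z : G × G => dist (φ (z.2 - t₀)) (φ (z.2 - z.1)) :=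
      (φ.continuous.comp (by fun_prop)).dist (φ.continuous.comp (by fun_prop))
    exact (hcont.tendsto (t₀, s)).eventually (gt_mem_nhds (by simpa using hε))
  filter_upwards [hN0, hunif] with t ht h s
  by_cases hs : s ∈ tsupport φ + N
  · exact h s hs
  · simpa [← heq t ht s hs] using hε

theorem IsLocallyBounded.continuous_ccTranslate {A : Type*} [NormedAddCommGroup A]
    [NormedSpace ℂ A] {ι : C_c(G, ℂ) →ₗ[ℂ] A} (hι : IsLocallyBounded ι) (φ : C_c(G, ℂ)) :
    Continuous fun t => ι (ccTranslate t φ) :=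
  continuous_iff_continuousAt.2 fun t₀ => hι.tendsto (tendstoCc_ccTranslate φ t₀)

end Translation

section Integration

open scoped CompactlySupported

variable {G : Type*} [AddCommGroup G] [TopologicalSpace G] [IsTopologicalAddGroup G]
  [LocallyCompactSpace G] [MeasurableSpace G] [BorelSpace G] (μ : Measure G)
  [IsFiniteMeasureOnCompacts μ]

theorem exists_cc_integral_eq_one [μ.IsOpenPosMeasure] {V : Set G} (hV : V ∈ 𝓝 0) :
    ∃ e : C_c(G, ℂ), Function.support e ⊆ V ∧ ∫ t, e t ∂μ = 1 ∧ ∫ t, ‖e t‖ ∂μ = 1 := by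
  obtain ⟨f, hf1, hf0, hfc, hf01⟩ := exists_continuous_one_zero_of_isCompact
    (isCompact_singleton (x := (0 : G))) isOpen_interior.isClosed_compl
    (by simpa using mem_interior_iff_mem_nhds.2 hV)
  set I : ℝ := ∫ t, f t ∂μ
  have hI : 0 < I := f.continuous.integral_pos_of_hasCompactSupport_nonneg_nonzero hfc
    (fun t => (hf01 t).1) (x := 0) (by simp [hf1 rfl])
  obtain ⟨e, he⟩ : ∃ e : C_c(G, ℂ), ∀ t, e t = ((f t / I : ℝ) : ℂ) :=
    ⟨⟨⟨_, Complex.continuous_ofReal.comp (f.continuous.div_const I)⟩,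
      hfc.comp_left (g := fun x : ℝ => ((x / I : ℝ) : ℂ)) (by simp)⟩, fun _ => rfl⟩
  have hnorm : ∀ t, ‖e t‖ = f t / I := fun t => by
    rw [he, Complex.norm_real, Real.norm_of_nonneg (div_nonneg (hf01 t).1 hI.le)]
  refine ⟨e, fun t ht => ?_, ?_, ?_⟩
  · by_contra h
    exact ht (by simp [he, hf0 fun h' => h (interior_subset h')])
  · simp only [he]
    rw [integral_complex_ofReal, integral_div, div_self hI.ne', Complex.ofReal_one]
  · simp only [hnorm]
    rw [integral_div, div_self hI.ne']

theorem exists_approximateIdentity [μ.IsOpenPosMeasure] :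
    ∃ l : Filter C_c(G, ℂ), l.NeBot ∧
      Tendsto (fun e : C_c(G, ℂ) => Function.support e) l (𝓝 0).smallSets ∧
        ∀ᶠ e in l, ∫ t, e t ∂μ = 1 ∧ ∫ t, ‖e t‖ ∂μ = 1 := by
  refine ⟨(𝓝 0).smallSets.comap (fun e : C_c(G, ℂ) => Function.support e) ⊓
    𝓟 {e | ∫ t, e t ∂μ = 1 ∧ ∫ t, ‖e t‖ ∂μ = 1}, ?_, tendsto_comap.mono_left inf_le_left,
    mem_inf_of_right (mem_principal_self _)⟩
  refine inf_principal_neBot_iff.2 fun s hs => ?_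
  obtain ⟨V, hV, hVs⟩ := (((𝓝 (0 : G)).hasBasis_smallSets.comap _).mem_iff).1 hs
  obtain ⟨e, he, h⟩ := exists_cc_integral_eq_one μ hV
  exact ⟨e, hVs he, h⟩

theorem integrable_smul_ccToBounded_ccTranslate (h φ : C_c(G, ℂ)) :
    Integrable (fun t => h t • ccToBounded (ccTranslate t φ)) μ :=
  (h.continuous.smul (isLocallyBounded_ccToBounded.continuous_ccTranslate φ)
    ).integrable_of_hasCompactSupport h.hasCompactSupport.smul_right

end Integration

/-! ### Convolution of compactly supported continuous functions -/

section Convolution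

open scoped CompactlySupported Pointwise

variable {G : Type*} [AddCommGroup G] [TopologicalSpace G] [IsTopologicalAddGroup G]
  [T2Space G] [MeasurableSpace G] [BorelSpace G] {μ : Measure G} [IsLocallyFiniteMeasure μ]

variable (μ) in
/-- Convolution on `C_c(G)`. -/
noncomputable def ccConv (φ ψ : C_c(G, ℂ)) : C_c(G, ℂ) where
  toFun := φ ⋆[ContinuousLinearMap.mul ℂ ℂ, μ] ψ
  continuous_toFun := ψ.hasCompactSupport.continuous_convolution_right _
    φ.continuous.locallyIntegrable ψ.continuous
  hasCompactSupport' := φ.hasCompactSupport.convolution _ ψ.hasCompactSupport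

theorem coe_ccConv (φ ψ : C_c(G, ℂ)) :
    ⇑(ccConv μ φ ψ) = φ ⋆[ContinuousLinearMap.mul ℂ ℂ, μ] ψ := rfl

theorem ccConv_apply (φ ψ : C_c(G, ℂ)) (x : G) :
    ccConv μ φ ψ x = ∫ t, φ t * ψ (x - t) ∂μ := rfl

theorem ccConv_comm [μ.IsAddLeftInvariant] [μ.IsNegInvariant] (φ ψ : C_c(G, ℂ)) :
    ccConv μ φ ψ = ccConv μ ψ φ := by
  refine DFunLike.coe_injective ?_
  rw [coe_ccConv, coe_ccConv, ← convolution_flip, ContinuousLinearMap.flip_mul]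

theorem ccConv_translate_right (t : G) (φ ψ : C_c(G, ℂ)) :
    ccConv μ φ (ccTranslate t ψ) = ccTranslate t (ccConv μ φ ψ) := by
  ext x
  simp only [ccConv_apply, ccTranslate_apply, sub_right_comm]

theorem ccConv_translate_left [μ.IsAddLeftInvariant] [μ.IsNegInvariant] (t : G)
    (φ ψ : C_c(G, ℂ)) : ccConv μ (ccTranslate t φ) ψ = ccTranslate t (ccConv μ φ ψ) := by
  rw [ccConv_comm, ccConv_translate_right, ccConv_comm]

theorem norm_ccConv_sub_le {e φ : C_c(G, ℂ)} {x : G} {δ : ℝ} (he : ∫ t, e t ∂μ = 1)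
    (hnorm : ∫ t, ‖e t‖ ∂μ ≤ 1) (hδ : 0 ≤ δ)
    (h : ∀ t ∈ Function.support e, ‖φ (x - t) - φ x‖ ≤ δ) : ‖ccConv μ e φ x - φ x‖ ≤ δ := by
  have hei : Integrable e μ := e.continuous.integrable_of_hasCompactSupport e.hasCompactSupport
  have hci : Integrable (fun t => e t * φ (x - t)) μ :=
    (φ.hasCompactSupport.convolutionExists_right (ContinuousLinearMap.mul ℂ ℂ)
      e.continuous.locallyIntegrable φ.continuous) x
  have hsub : ccConv μ e φ x - φ x = ∫ t, e t * (φ (x - t) - φ x) ∂μ := by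
    simp only [mul_sub]
    rw [integral_sub hci (hei.mul_const _), integral_mul_const, he, one_mul, ccConv_apply]
  calc ‖ccConv μ e φ x - φ x‖ = ‖∫ t, e t * (φ (x - t) - φ x) ∂μ‖ := by rw [hsub]
    _ ≤ ∫ t, ‖e t‖ * δ ∂μ := by
        refine norm_integral_le_of_norm_le (hei.norm.mul_const _) (.of_forall fun t => ?_)
        by_cases ht : e t = 0
        · simp [ht]
        · rw [norm_mul]
          gcongr
          exact h t ht
    _ ≤ δ := by
        rw [integral_mul_const]
        exact mul_le_of_le_one_left hδ hnorm

variable [LocallyCompactSpace G]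

theorem tendstoCc_ccConv {α : Type*} {l : Filter α} {e : α → C_c(G, ℂ)}
    (hsupp : Tendsto (fun a => Function.support (e a)) l (𝓝 0).smallSets)
    (hint : ∀ᶠ a in l, ∫ t, e a t ∂μ = 1) (hnorm : ∀ᶠ a in l, ∫ t, ‖e a t‖ ∂μ ≤ 1)
    (φ : C_c(G, ℂ)) : TendstoCc (fun a => ccConv μ (e a) φ) l φ := by
  obtain ⟨⟨K, hK, hφK⟩, hφ⟩ := tendstoCc_ccTranslate φ 0
  simp only [ccTranslate_zero, ccTranslate_apply] at hφK hφ
  refine ⟨⟨K, hK, ?_⟩, Metric.tendstoUniformly_iff.2 fun ε hε => ?_⟩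
  · filter_upwards [tendsto_smallSets_iff.1 hsupp _ hφK, hint, hnorm] with a ha hi hn s hs
    refine sub_eq_zero.1 (norm_le_zero_iff.1 (norm_ccConv_sub_le hi hn le_rfl fun t ht => ?_))
    rw [show φ (s - t) = φ s from ha ht s hs, sub_self, norm_zero]
  · filter_upwards [tendsto_smallSets_iff.1 hsupp _
      (Metric.tendstoUniformly_iff.1 hφ _ (half_pos hε)), hint, hnorm] with a ha hi hn s
    rw [dist_comm, dist_eq_norm]
    refine (norm_ccConv_sub_le hi hn (half_pos hε).le fun t ht => ?_).trans_lt (half_lt_self hε)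
    rw [← dist_eq_norm, dist_comm]
    exact (ha ht s).le

variable (μ) in
theorem IsLocallyBounded.mem_closure_range_ccConv [μ.IsOpenPosMeasure] {A : Type*}
    [NormedAddCommGroup A] [NormedSpace ℂ A] {ι : C_c(G, ℂ) →ₗ[ℂ] A} (hι : IsLocallyBounded ι)
    (φ : C_c(G, ℂ)) : ι φ ∈ closure (Set.range fun e => ι (ccConv μ e φ)) := by
  obtain ⟨l, _, hsupp, hint⟩ := exists_approximateIdentity μ
  exact mem_closure_of_tendsto
    (hι.tendsto (tendstoCc_ccConv hsupp (hint.mono fun _ h => h.1) (hint.mono fun _ h => h.2.le) φ))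
    (.of_forall fun e => Set.mem_range_self e)

theorem ccToBounded_ccConv (h φ : C_c(G, ℂ)) :
    ccToBounded (ccConv μ h φ) = ∫ t, h t • ccToBounded (ccTranslate t φ) ∂μ := by
  ext x
  exact (BoundedContinuousFunction.evalCLM ℂ x).integral_comp_comm
    (integrable_smul_ccToBounded_ccTranslate μ h φ)

theorem IsLocallyBounded.apply_ccConv {Λ : C_c(G, ℂ) →ₗ[ℂ] ℂ} (hΛ : IsLocallyBounded Λ)
    (h φ : C_c(G, ℂ)) : Λ (ccConv μ h φ) = ∫ t, h t * Λ (ccTranslate t φ) ∂μ := by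
  obtain ⟨T, hT⟩ := hΛ.exists_clm_eq
    (h.hasCompactSupport.isCompact.add φ.hasCompactSupport.isCompact)
  have hvan : ∀ t, ∀ s ∉ tsupport h + tsupport φ, h t * φ (s - t) = 0 := fun t s hs => by
    by_contra hne
    exact hs ⟨t, subset_tsupport h (left_ne_zero_of_mul hne), s - t,
      subset_tsupport φ (right_ne_zero_of_mul hne), add_sub_cancel t s⟩
  rw [← hT (ccConv μ h φ) fun s hs => by simp [ccConv_apply, hvan _ s hs], ccToBounded_ccConv,
    ← T.integral_comp_comm (integrable_smul_ccToBounded_ccTranslate μ h φ)]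
  refine integral_congr_ae (.of_forall fun t => ?_)
  change T (h t • ccToBounded (ccTranslate t φ)) = _
  rw [← map_smul ccToBounded, hT (h t • ccTranslate t φ) (hvan t), map_smul, smul_eq_mul]

end Convolution

/-! ### Derivations and translations -/

section Defect

open scoped CompactlySupported

variable {G : Type*} [AddCommGroup G] [TopologicalSpace G] [IsTopologicalAddGroup G]
  {A : Type*} [NormedAddCommGroup A] [NormedSpace ℂ A]

/-- The amount `D(τ_t φ)(τ_{-t} ψ) - D(φ)(ψ)` by which `D : A → A*` fails to commute with the
translation `τ_t`, for `φ` and `ψ` in `C_c(G)` mapped to `A` by `ι`. -/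
noncomputable def translationDefect (ι : C_c(G, ℂ) →ₗ[ℂ] A) (D : A →L[ℂ] (A →L[ℂ] ℂ)) (t : G)
    (φ ψ : C_c(G, ℂ)) : ℂ :=
  D (ι (ccTranslate t φ)) (ι (ccTranslate (-t) ψ)) - D (ι φ) (ι ψ)

variable {ι : C_c(G, ℂ) →ₗ[ℂ] A} {D : A →L[ℂ] (A →L[ℂ] ℂ)}

theorem translationDefect_zero (φ ψ : C_c(G, ℂ)) : translationDefect ι D 0 φ ψ = 0 := by
  simp [translationDefect]

theorem translationDefect_add_eq (s t : G) (φ ψ : C_c(G, ℂ)) :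
    translationDefect ι D (s + t) φ ψ =
      translationDefect ι D s (ccTranslate t φ) (ccTranslate (-t) ψ) +
        translationDefect ι D t φ ψ := by
  simp only [translationDefect, ccTranslate_add, neg_add, sub_add_sub_cancel]

theorem norm_translationDefect_le {w : G → ℝ≥0}
    (hw : ∀ t φ, ‖ι (ccTranslate t φ)‖ ≤ w t * ‖ι φ‖) (t : G) (φ ψ : C_c(G, ℂ)) :
    ‖translationDefect ι D t φ ψ‖ ≤ 2 * ‖D‖ * ‖ι φ‖ * ‖ι ψ‖ * (w t * w (-t)) := by
  have hφ : ‖ι φ‖ ≤ w t * (w (-t) * ‖ι φ‖) := calc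
    ‖ι φ‖ = ‖ι (ccTranslate t (ccTranslate (-t) φ))‖ := by rw [ccTranslate_ccTranslate_neg]
    _ ≤ w t * ‖ι (ccTranslate (-t) φ)‖ := hw t _
    _ ≤ w t * (w (-t) * ‖ι φ‖) := by gcongr; exact hw (-t) φ
  calc ‖translationDefect ι D t φ ψ‖
      ≤ ‖D‖ * ‖ι (ccTranslate t φ)‖ * ‖ι (ccTranslate (-t) ψ)‖ + ‖D‖ * ‖ι φ‖ * ‖ι ψ‖ :=
        (norm_sub_le _ _).trans (add_le_add (D.le_opNorm₂ _ _) (D.le_opNorm₂ _ _))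
    _ ≤ ‖D‖ * (w t * ‖ι φ‖) * (w (-t) * ‖ι ψ‖) + ‖D‖ * (w t * (w (-t) * ‖ι φ‖)) * ‖ι ψ‖ := by
        gcongr
        exacts [hw t φ, hw (-t) ψ]
    _ = 2 * ‖D‖ * ‖ι φ‖ * ‖ι ψ‖ * (w t * w (-t)) := by ring

theorem IsLocallyBounded.continuous_translationDefect [LocallyCompactSpace G]
    (hι : IsLocallyBounded ι) (φ ψ : C_c(G, ℂ)) :
    Continuous fun t => translationDefect ι D t φ ψ :=
  ((D.continuous.comp (hι.continuous_ccTranslate φ)).clm_apply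
    ((hι.continuous_ccTranslate ψ).comp continuous_neg)).sub continuous_const

theorem IsLocallyBounded.eq_zero_of_forall_ccConv [LocallyCompactSpace G] [T2Space G]
    [MeasurableSpace G] [BorelSpace G] {μ : Measure G} [IsLocallyFiniteMeasure μ]
    [μ.IsOpenPosMeasure] (hι : IsLocallyBounded ι)
    {Λ : A →L[ℂ] ℂ} {φ : C_c(G, ℂ)}
    (h : ∀ e, Λ (ι (ccConv μ e φ)) = 0) : Λ (ι φ) = 0 :=
  closure_minimal (Set.range_subset_iff.2 h) (isClosed_singleton.preimage Λ.continuous)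
    (hι.mem_closure_range_ccConv μ φ)

end Defect

section Derivation

open scoped CompactlySupported

variable {G : Type*} [AddCommGroup G] [TopologicalSpace G] [IsTopologicalAddGroup G]
  [T2Space G] [MeasurableSpace G] [BorelSpace G] {μ : Measure G} [IsLocallyFiniteMeasure μ]
  {A : Type*} [NormedAddCommGroup A] [NormedSpace ℂ A] {ι : C_c(G, ℂ) →ₗ[ℂ] A}
  {m : BoundedMul A} {D : A →L[ℂ] (A →L[ℂ] ℂ)}

theorem derivation_ccConv (hmul : ∀ φ ψ, m.mul (ι φ) (ι ψ) = ι (ccConv μ φ ψ))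
    (hD : m.IsDerivation D) (f g c : C_c(G, ℂ)) :
    D (ι (ccConv μ f g)) (ι c) =
      D (ι g) (ι (ccConv μ c f)) + D (ι f) (ι (ccConv μ g c)) := by
  simpa [BoundedMul.dualLeft, BoundedMul.dualRight, hmul] using
    congrArg (fun Λ : A →L[ℂ] ℂ => Λ (ι c)) (hD (ι f) (ι g))

variable [μ.IsAddLeftInvariant] [μ.IsNegInvariant]

-- Both sides arise from expanding `D(τ_t(f * g))(τ_{-t} c)`, with `τ_t` on `f` or on `g`.
theorem translationDefect_rotate (hmul : ∀ φ ψ, m.mul (ι φ) (ι ψ) = ι (ccConv μ φ ψ))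
    (hD : m.IsDerivation D) (t : G) (f g c : C_c(G, ℂ)) :
    translationDefect ι D t f (ccConv μ g c) = translationDefect ι D t g (ccConv μ c f) := by
  have hf := derivation_ccConv hmul hD (ccTranslate t f) g (ccTranslate (-t) c)
  have hg := derivation_ccConv hmul hD f (ccTranslate t g) (ccTranslate (-t) c)
  simp only [ccConv_translate_left, ccConv_translate_right, ccTranslate_neg_ccTranslate,
    ccTranslate_ccTranslate_neg] at hf hg
  unfold translationDefect
  linear_combination hg - hf

theorem translationDefect_ccTranslate (hmul : ∀ φ ψ, m.mul (ι φ) (ι ψ) = ι (ccConv μ φ ψ))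
    (hD : m.IsDerivation D) (s t : G) (f g c : C_c(G, ℂ)) :
    translationDefect ι D s (ccTranslate t f) (ccTranslate (-t) (ccConv μ g c)) =
      translationDefect ι D s f (ccConv μ g c) := by
  rw [← ccConv_translate_right, translationDefect_rotate hmul hD, ccConv_translate_left,
    ccConv_translate_right, ccTranslate_neg_ccTranslate, ← translationDefect_rotate hmul hD]

theorem translationDefect_add (hmul : ∀ φ ψ, m.mul (ι φ) (ι ψ) = ι (ccConv μ φ ψ))
    (hD : m.IsDerivation D) (s t : G) (f g c : C_c(G, ℂ)) :
    translationDefect ι D (s + t) f (ccConv μ g c) =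
      translationDefect ι D s f (ccConv μ g c) + translationDefect ι D t f (ccConv μ g c) := by
  rw [translationDefect_add_eq, translationDefect_ccTranslate hmul hD]

theorem derivation_ccTranslate (hzero : ∀ t f g c, translationDefect ι D t f (ccConv μ g c) = 0)
    (t : G) (f g c : C_c(G, ℂ)) :
    D (ι (ccTranslate t f)) (ι (ccConv μ g c)) =
      D (ι f) (ι (ccTranslate t (ccConv μ g c))) := by
  have h := hzero t f (ccTranslate t g) c
  rwa [translationDefect, sub_eq_zero, ccConv_translate_left, ccTranslate_neg_ccTranslate] at h

variable [LocallyCompactSpace G] {w : G → ℝ≥0}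

theorem translationDefect_eq_zero (hmul : ∀ φ ψ, m.mul (ι φ) (ι ψ) = ι (ccConv μ φ ψ))
    (hD : m.IsDerivation D) (hι : IsLocallyBounded ι)
    (hw : ∀ t φ, ‖ι (ccTranslate t φ)‖ ≤ w t * ‖ι φ‖)
    (hξ : ∀ (ξ : G →ₜ+ ℂ) (B : ℝ), (∀ t, ‖ξ t‖ ≤ B * (w t * w (-t))) → ξ = 0)
    (t : G) (f g c : C_c(G, ℂ)) : translationDefect ι D t f (ccConv μ g c) = 0 :=
  let ξ : G →ₜ+ ℂ :=
    { toFun := fun t => translationDefect ι D t f (ccConv μ g c)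
      map_zero' := translationDefect_zero f _
      map_add' := fun s t => translationDefect_add hmul hD s t f g c
      continuous_toFun := hι.continuous_translationDefect f _ }
  DFunLike.congr_fun (hξ ξ _ fun t => norm_translationDefect_le hw t f _) t

theorem derivation_ccConv_left (hι : IsLocallyBounded ι)
    (hzero : ∀ t f g c, translationDefect ι D t f (ccConv μ g c) = 0) (h f g c : C_c(G, ℂ)) :
    D (ι (ccConv μ h f)) (ι (ccConv μ g c)) =
      D (ι f) (ι (ccConv μ h (ccConv μ g c))) := calc
  D (ι (ccConv μ h f)) (ι (ccConv μ g c))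
      = ∫ t, h t * D (ι (ccTranslate t f)) (ι (ccConv μ g c)) ∂μ :=
        (hι.comp (D.flip (ι (ccConv μ g c)))).apply_ccConv h f
  _ = ∫ t, h t * D (ι f) (ι (ccTranslate t (ccConv μ g c))) ∂μ := by
        simp only [derivation_ccTranslate hzero]
  _ = D (ι f) (ι (ccConv μ h (ccConv μ g c))) :=
        ((hι.comp (D (ι f))).apply_ccConv h (ccConv μ g c)).symm

theorem derivation_ccConv_ccConv_eq_zero
    (hmul : ∀ φ ψ, m.mul (ι φ) (ι ψ) = ι (ccConv μ φ ψ)) (hD : m.IsDerivation D)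
    (hι : IsLocallyBounded ι)
    (hzero : ∀ t f g c, translationDefect ι D t f (ccConv μ g c) = 0) (h f g c : C_c(G, ℂ)) :
    D (ι h) (ι (ccConv μ f (ccConv μ g c))) = 0 := by
  have hder := derivation_ccConv hmul hD h f (ccConv μ g c)
  rw [derivation_ccConv_left hι hzero, ccConv_comm (ccConv μ g c) h] at hder
  exact left_eq_add.1 hder

theorem derivation_eq_zero [μ.IsOpenPosMeasure]
    (hmul : ∀ φ ψ, m.mul (ι φ) (ι ψ) = ι (ccConv μ φ ψ))
    (hD : m.IsDerivation D) (hι : IsLocallyBounded ι) (hdense : DenseRange ι)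
    (hw : ∀ t φ, ‖ι (ccTranslate t φ)‖ ≤ w t * ‖ι φ‖)
    (hξ : ∀ (ξ : G →ₜ+ ℂ) (B : ℝ), (∀ t, ‖ξ t‖ ≤ B * (w t * w (-t))) → ξ = 0) : D = 0 := by
  have hvan : ∀ h c, D (ι h) (ι c) = 0 := fun h c =>
    hι.eq_zero_of_forall_ccConv (μ := μ) fun g => hι.eq_zero_of_forall_ccConv (μ := μ) fun f =>
      derivation_ccConv_ccConv_eq_zero hmul hD hι
        (translationDefect_eq_zero hmul hD hι hw hξ) h f g c
  exact DFunLike.coe_injective <| hdense.equalizer D.continuous continuous_const <| funext fun h =>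
    DFunLike.coe_injective <| hdense.equalizer (D (ι h)).continuous continuous_const <|
      funext (hvan h)

end Derivation

/-! ### Weights on locally compact groups -/

section Weight

variable {G : Type*} [AddCommGroup G] [TopologicalSpace G] [MeasurableSpace G] {μ : Measure G}

theorem Weight.norm_coe (ω : Weight μ) (s : G) : ‖(ω s : ℂ)‖ = ω s := by
  rw [Complex.norm_real, Real.norm_of_nonneg (ω.pos s).le]

theorem Weight.aemeasurable_comp_neg [MeasurableNeg G] [μ.IsNegInvariant] (ω : Weight μ) :
    AEMeasurable (fun s => ω (-s)) μ :=
  ω.aemeasurable.comp_quasiMeasurePreserving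
    (Measure.measurePreserving_neg μ).quasiMeasurePreserving

theorem Weight.memLp_top_div [MeasurableNeg G] [μ.IsNegInvariant] [OpensMeasurableSpace G]
    (ω : Weight μ) {ξ : G → ℂ} (hξ : Continuous ξ) {B : ℝ}
    (hB : ∀ s, ‖ξ s‖ ≤ B * (ω s * ω (-s))) :
    MemLp (fun s => ξ s / ((ω s * ω (-s) : ℝ) : ℂ)) ∞ μ := by
  have hmeas : AEMeasurable (fun s => ((ω s * ω (-s) : ℝ) : ℂ)) μ :=
    Complex.measurable_ofReal.comp_aemeasurable (ω.aemeasurable.mul ω.aemeasurable_comp_neg)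
  refine memLp_top_of_bound (hξ.measurable.aemeasurable.div hmeas).aestronglyMeasurable B
    (Eventually.of_forall fun s => ?_)
  have hpos := mul_pos (ω.pos s) (ω.pos (-s))
  rw [norm_div, Complex.norm_real, Real.norm_of_nonneg hpos.le, div_le_iff₀ hpos]
  exact hB s

variable [IsTopologicalAddGroup G] [LocallyCompactSpace G] [T2Space G] [BorelSpace G]
  [μ.IsAddHaarMeasure] [μ.Regular]

theorem Weight.exists_measurableSet_forall_le (ω : Weight μ) :
    ∃ (F : Set G) (n : ℕ), MeasurableSet F ∧ μ F ≠ 0 ∧ μ F ≠ ∞ ∧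
      ∀ s ∈ F, ω s ≤ n ∧ ω (-s) ≤ n := by
  obtain ⟨K, hK, hK0⟩ := exists_compact_mem_nhds (0 : G)
  let E : ℕ → Set G := fun n => K ∩ {s | ω s ≤ n ∧ ω (-s) ≤ n}
  have hE : K ⊆ ⋃ n, E n := fun s hs => by
    obtain ⟨n, hn⟩ := exists_nat_ge (max (ω s) (ω (-s)))
    exact Set.mem_iUnion.2 ⟨n, hs, max_le_iff.1 hn⟩
  obtain ⟨n, hn⟩ := exists_measure_pos_of_not_measure_iUnion_null fun h =>
    (Measure.measure_pos_of_mem_nhds μ hK0).ne' (measure_mono_null hE h)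
  have hnull : NullMeasurableSet (E n) μ :=
    hK.measurableSet.nullMeasurableSet.inter
      ((nullMeasurableSet_le ω.aemeasurable aemeasurable_const).inter
        (nullMeasurableSet_le ω.aemeasurable_comp_neg aemeasurable_const))
  obtain ⟨F, hFE, hF, hFae⟩ := hnull.exists_measurable_subset_ae_eq
  refine ⟨F, n, hF, by rw [measure_congr hFae]; exact hn.ne', ?_, fun s hs => (hFE hs).2⟩
  exact ne_top_of_le_ne_top (hK.measure_ne_top (μ := μ))
    (measure_mono (hFE.trans Set.inter_subset_left))

theorem Weight.exists_eventually_le (ω : Weight μ) : ∃ W : ℝ, ∀ᶠ s in 𝓝 (0 : G), ω s ≤ W := by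
  obtain ⟨C, hC, hsub⟩ := ω.weakly_submultiplicative
  obtain ⟨F, n, hF, hF0, hFtop, hFn⟩ := ω.exists_measurableSet_forall_le
  refine ⟨C * (n * n), ?_⟩
  filter_upwards [Measure.sub_mem_nhds_zero_of_addHaar_pos_ne_top μ F hF hF0.bot_lt hFtop]
  rintro _ ⟨a, ha, b, hb, rfl⟩
  calc ω (a - b) ≤ C * (ω a * ω (-b)) := sub_eq_add_neg a b ▸ hsub a (-b)
    _ ≤ C * (n * n) := by
        have := (ω.pos (-b)).le
        gcongr
        exacts [(hFn a ha).1, (hFn b hb).2]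

theorem Weight.boundedOnCompacts (ω : Weight μ) : BoundedOnCompacts fun s => (ω s : ℂ) := by
  obtain ⟨C, hC, hsub⟩ := ω.weakly_submultiplicative
  obtain ⟨W, hW⟩ := ω.exists_eventually_le
  intro K hK
  refine hK.induction_on ⟨0, by simp⟩ (fun s t hst ⟨W, hW⟩ => ⟨W, fun x hx => hW x (hst hx)⟩)
    (fun s t ⟨W, hW⟩ ⟨W', hW'⟩ => ⟨max W W', fun x hx => hx.elim
      (fun h => le_max_of_le_left (hW x h)) fun h => le_max_of_le_right (hW' x h)⟩) fun x _ => ?_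
  have hx : Tendsto (fun y => y - x) (𝓝 x) (𝓝 0) := tendsto_sub_nhds_zero_iff.2 tendsto_id
  refine ⟨_, mem_nhdsWithin_of_mem_nhds (hx.eventually hW), (C * (ω x * W)).toNNReal,
    fun y (hy : ω (y - x) ≤ W) => NNReal.le_toNNReal_of_coe_le ?_⟩
  rw [coe_nnnorm, ω.norm_coe]
  calc ω y = ω (x + (y - x)) := by rw [add_sub_cancel]
    _ ≤ C * (ω x * ω (y - x)) := hsub x (y - x)
    _ ≤ C * (ω x * W) := by
        have := (ω.pos x).le
        gcongr

theorem Weight.boundedOnCompacts_inv (ω : Weight μ) :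
    BoundedOnCompacts (fun s => (ω s : ℂ))⁻¹ := by
  obtain ⟨C, hC, hsub⟩ := ω.weakly_submultiplicative
  intro K hK
  obtain ⟨W, hW⟩ := ω.boundedOnCompacts (-K) hK.neg
  refine ⟨C.toNNReal * W, fun s hs => ?_⟩
  have hWs : ω (-s) ≤ W := (ω.norm_coe (-s)).symm.trans_le (hW (-s) (Set.neg_mem_neg.2 hs))
  rw [← NNReal.coe_le_coe, coe_nnnorm, Pi.inv_apply, norm_inv, ω.norm_coe, NNReal.coe_mul,
    Real.coe_toNNReal _ hC.le, inv_le_iff_one_le_mul₀ (ω.pos s)]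
  calc 1 = ω (s + -s) := by rw [add_neg_cancel, ω.map_zero]
    _ ≤ C * (ω s * ω (-s)) := hsub s (-s)
    _ ≤ C * (ω s * W) := by
        have := (ω.pos s).le
        gcongr
    _ = C * W * ω s := by ring

end Weight

/-! ### Compactly supported continuous functions in `S^Φ_ω(G)` -/

section CcClass

open scoped CompactlySupported

variable {G : Type*} [TopologicalSpace G] [MeasurableSpace G] {μ : Measure G}

/-- The class in `L⁰(μ)` of a compactly supported continuous function. -/
noncomputable def ccClass [OpensMeasurableSpace G] (μ : Measure G) :
    C_c(G, ℂ) →ₗ[ℂ] (G →ₘ[μ] ℂ) where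
  toFun φ := AEEqFun.mk φ φ.continuous.aestronglyMeasurable
  map_add' _ _ := rfl
  map_smul' _ _ := rfl

theorem coeFn_ccClass [OpensMeasurableSpace G] (φ : C_c(G, ℂ)) : ccClass μ φ =ᵐ[μ] φ :=
  AEEqFun.coeFn_mk _ _

variable [AddCommGroup G]

theorem isometry_toOrlicz (Y : YoungPair) (ω : Weight μ) : Isometry (toOrlicz Y ω) :=
  AddMonoidHomClass.isometry_of_norm _ fun _ => rfl

theorem isClosed_weightedOrliczS (Y : YoungPair) (ω : Weight μ) :
    IsClosed (weightedOrliczS Y ω : Set (weightedOrlicz Y ω)) :=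
  (Submodule.isClosed_topologicalClosure _).preimage (isometry_toOrlicz Y ω).continuous

theorem hasClassIn_mul_weight_iff {Y : YoungPair} {ω : Weight μ} {V : Submodule ℂ (orlicz Y μ)}
    {f : G →ₘ[μ] ℂ} :
    HasClassIn V (fun s => f s * (ω s : ℂ)) ↔
      ∃ h : f ∈ weightedOrlicz Y ω, toOrlicz Y ω ⟨f, h⟩ ∈ V := by
  refine ⟨fun ⟨g, hgV, hg⟩ => ?_, fun ⟨h, hV⟩ => ⟨_, hV, coeFn_mulWeight ω f⟩⟩
  have hgf : (g : G →ₘ[μ] ℂ) = mulWeight ω f := AEEqFun.ext (hg.trans (coeFn_mulWeight ω f).symm)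
  have hf : f ∈ weightedOrlicz Y ω := by
    rw [weightedOrlicz, Submodule.mem_comap, ← hgf]
    exact g.2
  have hgf' : toOrlicz Y ω ⟨f, hf⟩ = g := Subtype.ext hgf.symm
  exact ⟨hf, hgf' ▸ hgV⟩

theorem coeFn_mulWeight_ccClass [OpensMeasurableSpace G] (ω : Weight μ) (φ : C_c(G, ℂ)) :
    mulWeight ω (ccClass μ φ) =ᵐ[μ] fun s => φ s * (ω s : ℂ) := by
  filter_upwards [coeFn_mulWeight ω (ccClass μ φ), coeFn_ccClass (μ := μ) φ] with s hω hφ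
  rw [hω, hφ]

end CcClass

section CcEmbed

open scoped CompactlySupported

variable {G : Type*} [AddCommGroup G] [TopologicalSpace G] [IsTopologicalAddGroup G]
  [LocallyCompactSpace G] [T2Space G] [MeasurableSpace G] [BorelSpace G]
  {μ : Measure G} [μ.IsAddHaarMeasure] [μ.Regular]

theorem ccClass_mem_weightedOrliczS (Y : YoungPair) (ω : Weight μ) (φ : C_c(G, ℂ)) :
    ∃ h : ccClass μ φ ∈ weightedOrlicz Y ω,
      (⟨ccClass μ φ, h⟩ : weightedOrlicz Y ω) ∈ weightedOrliczS Y ω := by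
  obtain ⟨W, hW⟩ := ω.boundedOnCompacts _ φ.hasCompactSupport.isCompact
  obtain ⟨B, hB⟩ := φ.hasCompactSupport.exists_bound_of_continuous φ.continuous
  have hφ : ∀ s ∉ tsupport φ, φ s * (ω s : ℂ) = 0 := fun s hs => by
    rw [image_eq_zero_of_notMem_tsupport (f := φ) hs, zero_mul]
  have hM : ∀ s, ‖φ s * (ω s : ℂ)‖₊ ≤ B.toNNReal * W := fun s => by
    by_cases hs : s ∈ tsupport φ
    · rw [nnnorm_mul]
      exact mul_le_mul' (NNReal.le_toNNReal_of_coe_le (hB s)) (hW s hs)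
    · simp [hφ s hs]
  refine hasClassIn_mul_weight_iff.1 (HasClassIn.congr_ae
    (hasClassIn_orliczS_of_bounded (isClosed_tsupport φ).measurableSet
      (φ.hasCompactSupport.isCompact.measure_ne_top (μ := μ))
      (φ.continuous.aestronglyMeasurable.mul ω.aestronglyMeasurable) (ae_of_all μ hM) hφ) ?_)
  filter_upwards [coeFn_ccClass (μ := μ) φ] with s hs
  exact congrArg (· * (ω s : ℂ)) hs.symm

/-- The embedding of `C_c(G)` into `S^Φ_ω(G)`. -/
noncomputable def ccEmbed (Y : YoungPair) (ω : Weight μ) :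
    C_c(G, ℂ) →ₗ[ℂ] weightedOrliczS Y ω where
  toFun φ := ⟨⟨ccClass μ φ, (ccClass_mem_weightedOrliczS Y ω φ).1⟩,
    (ccClass_mem_weightedOrliczS Y ω φ).2⟩
  map_add' φ ψ := Subtype.ext (Subtype.ext (map_add (ccClass μ) φ ψ))
  map_smul' c φ := Subtype.ext (Subtype.ext (map_smul (ccClass μ) c φ))

variable (Y : YoungPair) (ω : Weight μ)

theorem norm_ccEmbed_le_mul {φ ψ : C_c(G, ℂ)} {c : ℝ≥0}
    (h : orliczENorm Y (mulWeight ω (ccClass μ φ)) ≤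
      c * orliczENorm Y (mulWeight ω (ccClass μ ψ))) :
    ‖ccEmbed Y ω φ‖ ≤ c * ‖ccEmbed Y ω ψ‖ :=
  norm_orlicz_le_mul (f := toOrlicz Y ω (ccEmbed Y ω φ)) (g := toOrlicz Y ω (ccEmbed Y ω ψ)) h

theorem isLocallyBounded_ccEmbed : IsLocallyBounded (ccEmbed Y ω) := by
  intro K hK
  obtain ⟨χ, hχ, -⟩ := exists_cc_eqOn_one hK isOpen_univ (Set.subset_univ K)
  refine ⟨‖ccEmbed Y ω χ‖₊, fun φ ε hε hφ => ?_⟩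
  rw [mul_comm]
  refine norm_ccEmbed_le_mul Y ω (orliczENorm_le_mul ε ?_)
  filter_upwards [coeFn_mulWeight_ccClass ω φ, coeFn_mulWeight_ccClass ω χ] with s hφs hχs
  rw [hφs, hχs, nnnorm_mul, nnnorm_mul, ← mul_assoc]
  gcongr
  by_cases hs : s ∈ K
  · simpa [hχ hs, ← NNReal.coe_le_coe] using hε s
  · simp [hφ s hs]

theorem norm_ccEmbed_ccTranslate_le {w : G → ℝ≥0} (hw : ∀ s t, ω (s + t) ≤ ω s * w t) (t : G)
    (φ : C_c(G, ℂ)) : ‖ccEmbed Y ω (ccTranslate t φ)‖ ≤ w t * ‖ccEmbed Y ω φ‖ := by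
  have he : MeasurePreserving (MeasurableEquiv.subRight t) μ μ := measurePreserving_sub_right μ t
  refine norm_ccEmbed_le_mul Y ω ((orliczENorm_le_mul (w t) ?_).trans
    (mul_le_mul_right (orliczENorm_compMeasurePreserving_le _ _ he) _))
  filter_upwards [coeFn_mulWeight_ccClass ω (ccTranslate t φ),
    AEEqFun.coeFn_compMeasurePreserving (mulWeight ω (ccClass μ φ)) he,
    he.quasiMeasurePreserving.ae (coeFn_mulWeight_ccClass ω φ)] with s hτ hcomp hφ
  have het : MeasurableEquiv.subRight t s = s - t := rfl
  rw [hτ, hcomp, Function.comp_apply, hφ, het, ccTranslate_apply, nnnorm_mul, nnnorm_mul,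
    mul_left_comm]
  gcongr
  have h := hw (s - t) t
  rw [sub_add_cancel, mul_comm] at h
  rwa [← NNReal.coe_le_coe, NNReal.coe_mul, coe_nnnorm, coe_nnnorm, ω.norm_coe, ω.norm_coe]

theorem denseRange_ccEmbed : DenseRange (ccEmbed Y ω) := by
  let j : weightedOrliczS Y ω →ₗ[ℂ] orlicz Y μ := toOrlicz Y ω ∘ₗ (weightedOrliczS Y ω).subtype
  have hj : IsInducing j :=
    ((isometry_toOrlicz Y ω).comp isometry_subtype_coe).isEmbedding.isInducing
  let V := (LinearMap.range (j ∘ₗ ccEmbed Y ω)).topologicalClosure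
  have hcc : ∀ φ : C_c(G, ℂ), HasClassIn V (φ * fun s => (ω s : ℂ)) := fun φ =>
    ⟨j (ccEmbed Y ω φ), Submodule.le_topologicalClosure _ ⟨φ, rfl⟩, coeFn_mulWeight_ccClass ω φ⟩
  have hle : orliczS Y μ ≤ V :=
    orliczS_le_of_forall_cc (Submodule.isClosed_topologicalClosure _) ω.aestronglyMeasurable
      (fun s => Complex.ofReal_ne_zero.2 (ω.pos s).ne') ω.boundedOnCompacts
      ω.boundedOnCompacts_inv hcc
  intro a
  rw [hj.closure_eq_preimage_closure_image, ← Set.range_comp]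
  exact hle a.2

end CcEmbed

/-! ### Convolution on `S^Φ_ω(G)` -/

section WeakAmenability

open scoped CompactlySupported

variable {G : Type*} [AddCommGroup G] [TopologicalSpace G] [IsTopologicalAddGroup G]
  [MeasurableSpace G] [BorelSpace G] {μ : Measure G}

theorem convolution_congr_ae [μ.IsAddLeftInvariant] [μ.IsNegInvariant] {f f' g g' : G → ℂ}
    (hf : f =ᵐ[μ] f') (hg : g =ᵐ[μ] g') :
    f ⋆[ContinuousLinearMap.mul ℂ ℂ, μ] g = f' ⋆[ContinuousLinearMap.mul ℂ ℂ, μ] g' := by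
  ext x
  refine integral_congr_ae ?_
  filter_upwards [hf,
    (Measure.measurePreserving_sub_left μ x).quasiMeasurePreserving.ae hg] with t hft hgt
  rw [hft, hgt]

variable [T2Space G]

theorem BoundedMul.IsConvolution.coe_mul_eq_ccClass [IsLocallyFiniteMeasure μ]
    [μ.IsAddLeftInvariant] [μ.IsNegInvariant] {A : Type*} [NormedAddCommGroup A] [NormedSpace ℂ A]
    {m : BoundedMul A} {j : A → (G →ₘ[μ] ℂ)} (hm : m.IsConvolution j) {a b : A} {φ ψ : C_c(G, ℂ)}
    (ha : j a = ccClass μ φ) (hb : j b = ccClass μ ψ) :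
    j (m.mul a b) = ccClass μ (ccConv μ φ ψ) := by
  refine AEEqFun.ext ((hm a b).2.trans ?_)
  rw [ha, hb, convolution_congr_ae (coeFn_ccClass φ) (coeFn_ccClass ψ)]
  exact (coeFn_ccClass (ccConv μ φ ψ)).symm

variable [LocallyCompactSpace G] [μ.IsAddHaarMeasure] [μ.Regular] {Y : YoungPair} {ω : Weight μ}

theorem mul_mem_weightedOrliczS {m : BoundedMul (weightedOrlicz Y ω)}
    (hm : m.IsConvolution fun f => (f : G →ₘ[μ] ℂ)) (a b : weightedOrliczS Y ω) :
    m.mul a b ∈ weightedOrliczS Y ω := by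
  refine (denseRange_ccEmbed Y ω).induction_on₂
    (p := fun a b : weightedOrliczS Y ω => m.mul a b ∈ weightedOrliczS Y ω) ?_ ?_ a b
  · exact (isClosed_weightedOrliczS Y ω).preimage <|
      (m.mul.continuous.comp (continuous_subtype_val.comp continuous_fst)).clm_apply
        (continuous_subtype_val.comp continuous_snd)
  · intro φ ψ
    have hφψ : m.mul (ccEmbed Y ω φ) (ccEmbed Y ω ψ) = ccEmbed Y ω (ccConv μ φ ψ) :=
      Subtype.ext (hm.coe_mul_eq_ccClass rfl rfl)
    exact hφψ ▸ (ccEmbed Y ω _).2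

/-- The restriction of the convolution product of `L^Φ_ω(G)` to `S^Φ_ω(G)`. -/
noncomputable def restrictMul {m : BoundedMul (weightedOrlicz Y ω)}
    (hm : m.IsConvolution fun f => (f : G →ₘ[μ] ℂ)) : BoundedMul (weightedOrliczS Y ω) where
  mul := LinearMap.mkContinuous₂
    (LinearMap.mk₂ ℂ (fun a b => ⟨m.mul a b, mul_mem_weightedOrliczS hm a b⟩)
      (fun a a' b => Subtype.ext (by simp))
      (fun c a b => Subtype.ext (by simp))
      (fun a b b' => Subtype.ext (by simp))
      (fun c a b => Subtype.ext (by simp))) ‖m.mul‖ fun a b => m.mul.le_opNorm₂ a b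
  assoc a b c := Subtype.ext (m.assoc a b c)

theorem isConvolution_restrictMul {m : BoundedMul (weightedOrlicz Y ω)}
    (hm : m.IsConvolution fun f => (f : G →ₘ[μ] ℂ)) :
    (restrictMul hm).IsConvolution fun f => ((f : weightedOrlicz Y ω) : G →ₘ[μ] ℂ) :=
  fun f g => hm f g

theorem BoundedMul.IsConvolution.derivation_eq_zero {m : BoundedMul (weightedOrliczS Y ω)}
    (hm : m.IsConvolution fun f => ((f : weightedOrlicz Y ω) : G →ₘ[μ] ℂ))
    (hξ : ¬ ∃ ξ : G →ₜ+ ℂ, ξ ≠ 0 ∧ MemLp (fun s => ξ s / ((ω s * ω (-s) : ℝ) : ℂ)) ∞ μ)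
    {D : weightedOrliczS Y ω →L[ℂ] (weightedOrliczS Y ω →L[ℂ] ℂ)} (hD : m.IsDerivation D) :
    D = 0 := by
  obtain ⟨C, hC, hsub⟩ := ω.weakly_submultiplicative
  let w : G → ℝ≥0 := fun t => ⟨C * ω t, mul_nonneg hC.le (ω.pos t).le⟩
  have hw : ∀ s t, ω (s + t) ≤ ω s * w t := fun s t => (hsub s t).trans_eq (mul_left_comm _ _ _)
  refine WeightedOrlicz.derivation_eq_zero
    (fun φ ψ => Subtype.ext (Subtype.ext (hm.coe_mul_eq_ccClass rfl rfl))) hD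
    (isLocallyBounded_ccEmbed Y ω) (denseRange_ccEmbed Y ω)
    (norm_ccEmbed_ccTranslate_le Y ω hw) fun ξ B hB => ?_
  by_contra hne
  exact hξ ⟨ξ, hne, ω.memLp_top_div ξ.continuous_toFun fun t => (hB t).trans_eq <|
    show B * (C * ω t * (C * ω (-t))) = B * C ^ 2 * (ω t * ω (-t)) by ring⟩

theorem BoundedMul.isWeaklyAmenable_of_forall_eq_zero {A : Type*} [NormedAddCommGroup A]
    [NormedSpace ℂ A] {m : BoundedMul A} (h : ∀ D, m.IsDerivation D → D = 0) :
    m.IsWeaklyAmenable := fun D hD =>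
  ⟨0, fun a => by simp [h D hD, BoundedMul.dualLeft, BoundedMul.dualRight]⟩

end WeakAmenability

end WeightedOrlicz

theorem mainTheorem1 {G : Type*} [AddCommGroup G] [TopologicalSpace G] [IsTopologicalAddGroup G]
    [LocallyCompactSpace G] [T2Space G] [MeasurableSpace G] [BorelSpace G]
    (μ : Measure G) [μ.IsAddHaarMeasure] [μ.Regular]
    (Y : WeightedOrlicz.YoungPair) (ω : WeightedOrlicz.Weight μ)
    (hL : WeightedOrlicz.IsWeightedOrliczAlgebra Y ω)
    (hξ : ¬ ∃ ξ : G →ₜ+ ℂ, ξ ≠ 0 ∧ MemLp (fun s => ξ s / ((ω s * ω (-s) : ℝ) : ℂ)) ∞ μ) :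
    WeightedOrlicz.IsWeaklyAmenableS Y ω := by
  obtain ⟨m, hm⟩ := hL
  have hS := WeightedOrlicz.isConvolution_restrictMul hm
  exact ⟨WeightedOrlicz.restrictMul hm, hS,
    WeightedOrlicz.BoundedMul.isWeaklyAmenable_of_forall_eq_zero fun D hD =>
      hS.derivation_eq_zero hξ hD⟩
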